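/- \textbf{Setting.} Let $k\ge 1$, $T\in\mathbb N$, and let $\mathcal K\subset\mathbb R^k$ be closed and convex with $r\mathbb B^k\subseteq\mathcal K\subseteq R\,\mathbb B^k$ for some $0<r<R$ and $\|x-y\|\le D$ for all $x,y\in\mathcal K$ (Euclidean norm). Let $f_1,\dots,f_T:\mathcal K\to\mathbb R$ be convex and differentiable with $\|\nabla f_t(x)\|\le G$ and $|f_t(x)|\le M$ for all $x\in\mathcal K$, where $G,M>0$; put $\nu=\frac{M}{Gr}$. The prediction of round $t$ is requested at time $l_t$ and its feedback arrives at time $r_t>l_t$, where $0<l_1<\dots<l_T$ and all timestamps $l_t,r_t$ are distinct; put $I_t=(l_t,r_t)$. Losses and timestamps are arbitrary and fixed in advance (oblivious adversary). Define the delays $d_t=|\{s:l_s\in I_t\}|$ (so feedback $t$ arrives in round $t+d_t$), $d_{\mathrm{tot}}=\sum_{t=1}^T d_t$, the dual delays $d^\star_t=|\{s:r_s\in I_t\}|$, the dual backlogs $\sigma^\star_t=|\{s:r_t\in I_s\}|$, and the permutation $\rho$ of $\{1,\dots,T\}$ with $r_{\rho(1)}<\dots<r_{\rho(T)}$. \textbf{Base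 algorithm (P-FTRL).} Given a starting point $z_1\in\mathcal K$, learning rates $\eta_n>0$ and successively revealed loss vectors $c_1,c_2,\dots$, it predicts \[ z_{n+1}=\operatorname*{arg\,min}_{z\in\mathcal K}\ \sum_{m=1}^n\Bigl(\langle c_m,z\rangle+\tfrac{\alpha_m}{2}\|z_m-z\|^2\Bigr),\qquad \alpha_1=\tfrac1{\eta_1},\quad \alpha_{m+1}=\tfrac1{\eta_{m+1}}-\tfrac1{\eta_m}. \] \textbf{Wrapper $\mathcal W_{\mathrm{BCO}}$.} Let $\bar z$ denote the current output of the base algorithm $\mathcal B$, initially $z_1$. In each round $t=1,\dots,T$ sample $u_t\sim\mathrm{Unif}(\mathbb S^{k-1})$ independently of the past and predict $x_t=(1-\frac{\delta_t}{r})\bar z+\delta_t u_t$; then, for each $s$ with $s+d_s=t$, in the order of observation, receive $f_s(x_s)$, send $\bigl(\frac{k}{\delta_s}f_s(x_s)u_s,\,d^\star_s,\,\sigma^\star_s\bigr)$ to $\mathcal B$ (the first entry being the next loss vector), and update $\bar z$. \textbf{Statement.} There is a universal constant $C>0$ such that the following holds in the above setting for every choice of $k$, $T$, $\mathcal K$,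 $r$, $R$, $D$, $G$, $M$, losses, timestamps and $z_1\in\mathcal K$. Let $\delta_t=r\min\bigl\{1,\frac{\sqrt{\nu k}}{t^{1/4}}\bigr\}$ for all $t$, or $\delta_t=r\min\bigl\{1,\frac{\sqrt{\nu k}}{T^{1/4}}\bigr\}$ for all $t$, and let $\mathcal B$ be P-FTRL with \[ \eta_n=\frac{D/G}{\sqrt{\,n+\sum_{m=1}^n\bigl(\sigma^\star_{\rho(m)}+(\nu k r/\delta'_m)^2\bigr)}},\qquad \delta'_m=\delta_{\rho(m)+d_{\rho(m)}}. \] Then for $x^*\in\operatorname*{arg\,min}_{x\in\mathcal K}\sum_{t=1}^T f_t(x)$ the regret of $\mathcal W_{\mathrm{BCO}}(\mathcal B)$ is integrable and \[ \mathbb E\Bigl[\sum_{t=1}^T\bigl(f_t(x_t)-f_t(x^*)\bigr)\Bigr]\ \le\ C\,G D\Bigl[\sqrt{d_{\mathrm{tot}}}+T^{3/4}\sqrt{\nu k}\Bigr]. \] -/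

import Mathlib

open MeasureTheory

/-- The Euclidean space `ℝ^k`. -/
abbrev Eucl (k : ℕ) : Type := EuclideanSpace ℝ (Fin k)

/-- The unit sphere `S^{k-1}` of `ℝ^k`. -/
abbrev USphere (k : ℕ) : Type := Metric.sphere (0 : Eucl k) 1

/-- The uniform distribution on `S^{k-1}`: normalized surface measure. -/
noncomputable def unifSphere (k : ℕ) : Measure (USphere k) :=
  ((volume : Measure (Eucl k)).toSphere Set.univ)⁻¹ • (volume : Measure (Eucl k)).toSphere

/-! ### Timing of predictions and observations

Rounds are indexed by `Fin T`; the index `t` stands for round number `t + 1`. -/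

/-- Latency intervals `I_t = (l_t, r_t)`: the prediction of round `t` is requested at time `l_t`
and its feedback is revealed at time `r_t`. All timestamps are distinct. -/
structure Timeline (T : ℕ) where
  l : Fin T → ℝ
  r : Fin T → ℝ
  l_pos : ∀ t, 0 < l t
  l_strictMono : StrictMono l
  l_lt_r : ∀ t, l t < r t
  r_injective : Function.Injective r
  l_ne_r : ∀ s t, l s ≠ r t

namespace Timeline

variable {T : ℕ} (τ : Timeline T)

/-- The latency interval `I_t`. -/
def interval (t : Fin T) : Set ℝ := Set.Ioo (τ.l t) (τ.r t)

open Classical in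
/-- The delay `d_t`: the number of predictions made while feedback `t` is outstanding. -/
noncomputable def delay (t : Fin T) : ℕ :=
  (Finset.univ.filter fun s => τ.l s ∈ τ.interval t).card

open Classical in
/-- The dual delay: the number of observations received while feedback `t` is outstanding. -/
noncomputable def dualDelay (t : Fin T) : ℕ :=
  (Finset.univ.filter fun s => τ.r s ∈ τ.interval t).card

open Classical in
/-- The dual backlog: the number of predictions awaiting feedback when feedback `t` arrives. -/
noncomputable def dualBacklog (t : Fin T) : ℕ :=
  (Finset.univ.filter fun s => τ.r t ∈ τ.interval s).card

/-- The total delay. -/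
noncomputable def totalDelay : ℕ := ∑ t, τ.delay t

/-- The observation order: the permutation `ρ` of the rounds along which `r` is increasing. -/
noncomputable def obsOrder : Equiv.Perm (Fin T) := Tuple.sort τ.r

/-- The rounds `s` with `s + d_s = t`, whose feedback arrives in round `t`, in observation
order. -/
noncomputable def observedIn (t : Fin T) : List (Fin T) :=
  ((List.finRange T).map τ.obsOrder).filter fun (s : Fin T) => (s : ℕ) + τ.delay s = (t : ℕ)

end Timeline

/-! ### Online linear optimization with drift penalization, and P-FTRL -/

/-- A (deterministic) base algorithm: it maps the tuples (loss vector, lag, number of outstanding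
lags) revealed so far, oldest first, to its next prediction. -/
abbrev OLOAlgorithm (k : ℕ) : Type := List (Eucl k × ℕ × ℕ) → Eucl k

/-- A minimizer of `φ` over `K`, if there is one. -/
noncomputable def argminOn {k : ℕ} (K : Set (Eucl k)) (φ : Eucl k → ℝ) : Eucl k :=
  Classical.epsilon fun z => z ∈ K ∧ IsMinOn φ K z

/-- The regularization weights `α_1 = 1/η_1`, `α_{n+1} = 1/η_{n+1} - 1/η_n`. -/
noncomputable def pftrlWeight (η : ℕ → ℝ) : ℕ → ℝ
  | 0 => 0
  | 1 => 1 / η 1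
  | n + 2 => 1 / η (n + 2) - 1 / η (n + 1)

/-- The P-FTRL iterates: `pftrlIterate K z₁ η c n` is `z_{n+1}`, the prediction after the loss
vectors `c 0, …, c (n-1)`. With `c_{m+1} = c m`,
`z_{n+1} = argmin_{z ∈ K} ∑_{m=1}^{n} (⟨c_m, z⟩ + α_m ‖z_m - z‖² / 2)`. -/
noncomputable def pftrlIterate {k : ℕ} (K : Set (Eucl k)) (z₁ : Eucl k) (η : ℕ → ℝ)
    (c : ℕ → Eucl k) : ℕ → Eucl k
  | 0 => z₁
  | n + 1 => argminOn K fun z => ∑ m : Fin (n + 1),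
      (inner ℝ (c (m : ℕ)) z
        + pftrlWeight η ((m : ℕ) + 1) * ‖pftrlIterate K z₁ η c (m : ℕ) - z‖ ^ 2 / 2)
  termination_by n => n
  decreasing_by exact m.isLt

/-- P-FTRL with domain `K`, initial point `z₁` and learning rates `η_1, η_2, …`. -/
noncomputable def pftrl {k : ℕ} (K : Set (Eucl k)) (z₁ : Eucl k) (η : ℕ → ℝ) : OLOAlgorithm k :=
  fun h => pftrlIterate K z₁ η (fun m => (h.getD m 0).1) h.length

/-! ### The bandit wrapper -/

/-- The state of the wrapper: the tuples sent to the base algorithm so far, and the predictions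
made so far (`0` for future rounds). -/
structure WrapperState (k T : ℕ) where
  sent : List (Eucl k × ℕ × ℕ)
  pred : Fin T → Eucl k

section Wrapper

variable {k T : ℕ} (B : OLOAlgorithm k) (r : ℝ) (δ : ℕ → ℝ) (τ : Timeline T)
  (f : Fin T → Eucl k → ℝ) (u : Fin T → USphere k)

/-- Round `t`: predict `x_t = (1 - δ_t/r) z̄ + δ_t u_t`, where `z̄` is the current output of the
base algorithm; then, for every `s` with `s + d_s = t` in observation order, receive `f_s(x_s)` and
send the single-point gradient estimate `(k/δ_s) f_s(x_s) u_s`, the dual delay and the dual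
backlog of `s` to the base algorithm. `δ` takes round numbers `1, 2, …`. -/
noncomputable def wrapperRound (t : Fin T) (S : WrapperState k T) : WrapperState k T :=
  let x : Fin T → Eucl k := Function.update S.pred t
    ((1 - δ ((t : ℕ) + 1) / r) • B S.sent + δ ((t : ℕ) + 1) • (u t : Eucl k))
  { sent := S.sent ++ (τ.observedIn t).map fun (s : Fin T) =>
      (((k : ℝ) / δ ((s : ℕ) + 1) * f s (x s)) • (u s : Eucl k), τ.dualDelay s, τ.dualBacklog s)
    pred := x }

/-- The state after the first `n` rounds. -/
noncomputable def wrapperState : ℕ → WrapperState k T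
  | 0 => ⟨[], 0⟩
  | n + 1 => if h : n < T then wrapperRound B r δ τ f u ⟨n, h⟩ (wrapperState n)
      else wrapperState n

/-- The prediction `x_t` of the wrapper, as a function of the sampled directions `u`. -/
noncomputable def wrapperPred (t : Fin T) : Eucl k := (wrapperState B r δ τ f u T).pred t

/-- The regret `∑_t (f_t(x_t) - f_t(v))` of the wrapper against `v`. -/
noncomputable def wrapperRegret (v : Eucl k) : ℝ :=
  ∑ t, (f t (wrapperPred B r δ τ f u t) - f t v)

end Wrapper

/-- The joint law of the directions `u_1, …, u_T`, independent and uniform on `S^{k-1}`. -/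
noncomputable def directionLaw (k T : ℕ) : Measure (Fin T → USphere k) :=
  Measure.pi fun _ => unifSphere k

/-! ### Parameters -/

/-- Round-dependent smoothing `δ_t = r min {1, √(νk) / t^{1/4}}`. -/
noncomputable def roundSchedule (k : ℕ) (r ν : ℝ) (t : ℕ) : ℝ :=
  r * min 1 (√(ν * k) / (t : ℝ) ^ (1 / 4 : ℝ))

/-- Fixed smoothing `δ_t = r min {1, √(νk) / T^{1/4}}`. -/
noncomputable def fixedSchedule (k T : ℕ) (r ν : ℝ) (_t : ℕ) : ℝ :=
  r * min 1 (√(ν * k) / (T : ℝ) ^ (1 / 4 : ℝ))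

/-- The learning rate
`η_n = (D/G) / √(n + ∑_{m=1}^n (σ̃*_m + (νkr/δ'_m)²))`, where `σ̃*_m` is the dual backlog of the
`m`-th observed round `ρ(m)` and `δ'_m = δ_{ρ(m) + d_{ρ(m)}}`. -/
noncomputable def learningRate {T : ℕ} (k : ℕ) (D G r ν : ℝ) (δ : ℕ → ℝ) (τ : Timeline T)
    (n : ℕ) : ℝ :=
  (D / G) / √((n : ℝ) + ∑ m ∈ Finset.univ.filter (fun m : Fin T => (m : ℕ) + 1 ≤ n),
    ((τ.dualBacklog (τ.obsOrder m) : ℝ)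
      + (ν * k * r / δ ((τ.obsOrder m : ℕ) + 1 + τ.delay (τ.obsOrder m))) ^ 2))

/-! ### The uniform distribution on the sphere -/

/-! The proof compares the delayed bandit run with an undelayed run of P-FTRL on the observed loss
vectors `c_t`, paying separately for bias, drift and noise.

Bias. Let `g_t` be the conditional mean of `c_t`. Reflection symmetry of the sphere, instead of
Stokes' theorem, gives `‖g_t‖ ≤ G` (`norm_meanGrad_le`) and, for convex losses, a subgradient
inequality up to `4Gδ` (`inner_meanGrad_le`). With the shrinking of the domain, a round costs at
most `⟨g_t, z_seen - x⟩ + 7GDδ_t/r` (`round_regret_le`), where `z_seen` is the iterate used for the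
prediction.

Delay. Let `z_obs` be the iterate just before feedback `t` is processed. Replacing `z_seen` by
`z_obs` costs `G‖z_obs - z_seen‖`. Since `z_obs` does not depend on `u_t` (`wrapperIterate_update`),
`g_t` may then be replaced by `c_t` in expectation, which leaves the ordinary P-FTRL regret
(`IsProximalFTRL.regret_le`).

Drift. In observation order the errors `c - g` are orthogonal in mean. With `L` a bound on the loss
vectors, a sum of `n` of them has mean norm at most `nG + 2L√n ≤ 2nG + L²/G`: the noise costs one
constant per interval, not one term per step (`integral_norm_sum_loss_le`). The optimality
conditions of P-FTRL turn this into a recursion for the mean drift, with solution `(L²/G)η + ∑ 2Gη`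
(`integral_drift_le`).

Summation. Exchanging sums, the second drift term becomes dual backlogs times learning rates; the
dual backlogs add up to the total delay and sit in the denominators of the rates, which yields
`√d_tot`. For the first term, a round that has seen half of the feedback has a small rate; the other
rounds number at most `2√d_tot`, and their drift is at most `D`. The tuning needs `1/√T ≤ νk ≤ √T`;
outside this range trivial regret bounds suffice. -/

section Sphere

variable {k : ℕ}

/-- The action of a linear isometry on the unit sphere. -/
noncomputable def sphereMap (e : Eucl k ≃ₗᵢ[ℝ] Eucl k) (u : USphere k) : USphere k :=
  ⟨e u, by simp⟩

lemma continuous_sphereMap (e : Eucl k ≃ₗᵢ[ℝ] Eucl k) : Continuous (sphereMap e) :=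
  (e.continuous.comp continuous_subtype_val).subtype_mk _

lemma nontrivial_eucl (hk : 1 ≤ k) : Nontrivial (Eucl k) := by
  have : Nonempty (Fin k) := ⟨⟨0, hk⟩⟩
  infer_instance

lemma isProbabilityMeasure_unifSphere (hk : 1 ≤ k) : IsProbabilityMeasure (unifSphere k) := by
  have := nontrivial_eucl hk
  refine ⟨?_⟩
  have h0 : (volume : Measure (Eucl k)).toSphere Set.univ ≠ 0 := by
    rw [Ne, Measure.measure_univ_eq_zero]
    exact Measure.toSphere_ne_zero _
  have h1 : (volume : Measure (Eucl k)).toSphere Set.univ ≠ ⊤ := measure_ne_top _ _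
  simp only [unifSphere, Measure.smul_apply, smul_eq_mul]
  exact ENNReal.inv_mul_cancel h0 h1

/-- The surface measure of a set is a multiple of the volume of the cone over it, and linear
isometries commute with forming cones and preserve volume. -/
lemma toSphere_map_sphereMap (e : Eucl k ≃ₗᵢ[ℝ] Eucl k) :
    (volume : Measure (Eucl k)).toSphere.map (sphereMap e)
      = (volume : Measure (Eucl k)).toSphere := by
  ext s hs
  have hm := (continuous_sphereMap e).measurable
  rw [Measure.map_apply hm hs, Measure.toSphere_apply' _ hs, Measure.toSphere_apply' _ (hm hs)]
  congr 1
  symm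
  rw [← e.measurePreserving.measure_preimage_equiv (f := e.toMeasurableEquiv)]
  congr 1
  ext x
  simp only [Set.mem_preimage, Set.mem_smul, Set.mem_image]
  constructor
  · rintro ⟨a, ha, _, ⟨u, hu, rfl⟩, h⟩
    refine ⟨a, ha, _, ⟨sphereMap e.symm u, ?_, rfl⟩, ?_⟩
    · simpa [sphereMap] using hu
    · have : e x = a • (u : Eucl k) := h.symm
      simp [sphereMap, ← map_smul, ← this]
  · rintro ⟨a, ha, _, ⟨u, hu, rfl⟩, rfl⟩
    exact ⟨a, ha, _, ⟨_, hu, rfl⟩, by simp [sphereMap]⟩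

lemma unifSphere_map_sphereMap (e : Eucl k ≃ₗᵢ[ℝ] Eucl k) :
    (unifSphere k).map (sphereMap e) = unifSphere k := by
  rw [unifSphere, Measure.map_smul, toSphere_map_sphereMap]

lemma integral_sphereMap (e : Eucl k ≃ₗᵢ[ℝ] Eucl k) {h : USphere k → ℝ} (hh : Continuous h) :
    ∫ u, h (sphereMap e u) ∂(unifSphere k) = ∫ u, h u ∂(unifSphere k) := by
  conv_rhs => rw [← unifSphere_map_sphereMap e]
  rw [integral_map (continuous_sphereMap e).aemeasurable hh.aestronglyMeasurable]

/-- A continuous function on a compact space is integrable against any finite measure. -/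
lemma Continuous.integrable_of_compactSpace {X E : Type*} [TopologicalSpace X] [CompactSpace X]
    [MeasurableSpace X] [OpensMeasurableSpace X] [NormedAddCommGroup E]
    [SecondCountableTopologyEither X E] {μ : Measure X} [IsFiniteMeasure μ] {h : X → E}
    (hh : Continuous h) : Integrable h μ :=
  hh.integrable_of_hasCompactSupport (HasCompactSupport.of_compactSpace h)

/-- Two vectors of equal norm are exchanged by the reflection in the hyperplane orthogonal to `v -
w`. Averaging over the coordinate directions then gives the second moment `‖v‖² / k` below. -/
lemma integral_inner_sq_unifSphere_eq {v w : Eucl k} (h : ‖v‖ = ‖w‖) :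
    ∫ u : USphere k, inner ℝ (u : Eucl k) v ^ 2 ∂(unifSphere k)
      = ∫ u : USphere k, inner ℝ (u : Eucl k) w ^ 2 ∂(unifSphere k) := by
  set e := (ℝ ∙ (v - w))ᗮ.reflection
  have he : e v = w := Submodule.reflection_sub h
  rw [← integral_sphereMap e (h := fun u : USphere k => inner ℝ (u : Eucl k) w ^ 2)
    (by fun_prop)]
  simp [sphereMap, ← he]

lemma integral_inner_sq_unifSphere (hk : 1 ≤ k) (v : Eucl k) :
    ∫ u : USphere k, inner ℝ (u : Eucl k) v ^ 2 ∂(unifSphere k) = ‖v‖ ^ 2 / k := by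
  have := isProbabilityMeasure_unifSphere hk
  have hk' : (k : ℝ) ≠ 0 := by positivity
  have key : ∀ i : Fin k, ∫ u : USphere k, inner ℝ (u : Eucl k) v ^ 2 ∂(unifSphere k)
      = ∫ u : USphere k, (‖v‖ * (u : Eucl k) i) ^ 2 ∂(unifSphere k) := by
    intro i
    rw [integral_inner_sq_unifSphere_eq (w := EuclideanSpace.single i ‖v‖) (by simp)]
    simp [EuclideanSpace.inner_single_right]
  have hsum : ∑ i : Fin k, ∫ u : USphere k, (‖v‖ * (u : Eucl k) i) ^ 2 ∂(unifSphere k)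
      = ‖v‖ ^ 2 := by
    rw [← integral_finsetSum]
    · have : ∀ u : USphere k, ∑ i : Fin k, (‖v‖ * (u : Eucl k) i) ^ 2 = ‖v‖ ^ 2 := by
        intro u
        simp_rw [mul_pow]
        rw [← Finset.mul_sum, ← EuclideanSpace.real_norm_sq_eq]
        simp
      simp [this]
    · intro i _
      exact Continuous.integrable_of_compactSpace (by fun_prop)
  simp_rw [← key] at hsum
  simp at hsum
  rw [← hsum]
  field_simp

/-! ### The single-point gradient estimate -/

/-- The single-point gradient estimate of `f` at `y` from the direction `u`. -/
noncomputable def gradEst (f : Eucl k → ℝ) (δ : ℝ) (y : Eucl k) (u : USphere k) : Eucl k :=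
  ((k : ℝ) / δ * f (y + δ • (u : Eucl k))) • (u : Eucl k)

/-- The mean of the single-point gradient estimate. -/
noncomputable def meanGrad (f : Eucl k → ℝ) (δ : ℝ) (y : Eucl k) : Eucl k :=
  ∫ u, gradEst f δ y u ∂(unifSphere k)

section Estimate

variable {K : Set (Eucl k)} {f : Eucl k → ℝ} {δ G : ℝ} {y p : Eucl k}

lemma continuous_eval_add_smul (hc : ContinuousOn f K)
    (hy : ∀ u : USphere k, y + δ • (u : Eucl k) ∈ K) :
    Continuous fun u : USphere k => f (y + δ • (u : Eucl k)) :=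
  hc.comp_continuous (by fun_prop) hy

lemma continuous_gradEst (hc : ContinuousOn f K) (hy : ∀ u : USphere k, y + δ • (u : Eucl k) ∈ K) :
    Continuous (gradEst f δ y) :=
  (continuous_const.mul (continuous_eval_add_smul hc hy)).smul continuous_subtype_val

lemma norm_gradEst_le {M : ℝ} (hδ : 0 < δ) (hM : ∀ x ∈ K, |f x| ≤ M) {u : USphere k}
    (hy : y + δ • (u : Eucl k) ∈ K) : ‖gradEst f δ y u‖ ≤ k * M / δ := by
  rw [gradEst, norm_smul, norm_mul, Real.norm_eq_abs, Real.norm_eq_abs,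
    abs_of_nonneg (by positivity)]
  have h1 : ‖(u : Eucl k)‖ = 1 := by simp
  rw [h1, mul_one, div_mul_eq_mul_div]
  have := hM _ hy
  gcongr

/-- Reflecting `u` in the hyperplane orthogonal to `p` preserves the law of `u` and flips the sign
of `⟨u, p⟩`. The mean is therefore an average of differences of `f` at two points separated by a
multiple of `p`, where Lipschitz and convexity bounds along `p` apply; no differentiability is
needed. -/
lemma inner_meanGrad (hk : 1 ≤ k) (hc : ContinuousOn f K)
    (hy : ∀ u : USphere k, y + δ • (u : Eucl k) ∈ K) :
    inner ℝ (meanGrad f δ y) p = k / (2 * δ) * ∫ u : USphere k,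
      (f (y + δ • (u : Eucl k)) - f (y + δ • ((ℝ ∙ p)ᗮ.reflection (u : Eucl k))))
        * inner ℝ (u : Eucl k) p ∂(unifSphere k) := by
  have := isProbabilityMeasure_unifSphere hk
  set e := (ℝ ∙ p)ᗮ.reflection with he
  have hf := continuous_eval_add_smul hc hy
  have hfe : Continuous fun u : USphere k => f (y + δ • e (u : Eucl k)) :=
    hf.comp (continuous_sphereMap e)
  have hrefl : ∀ u : USphere k, inner ℝ (e (u : Eucl k)) p = - inner ℝ (u : Eucl k) p := by
    intro u
    have h1 : e p = -p := Submodule.reflection_orthogonalComplement_singleton_eq_neg p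
    have h2 : inner ℝ (e (u : Eucl k)) (e p) = inner ℝ (u : Eucl k) p := e.inner_map_map _ _
    rw [h1, inner_neg_right] at h2
    linarith
  have h1 : inner ℝ (meanGrad f δ y) p
      = k / δ * ∫ u : USphere k, f (y + δ • (u : Eucl k)) * inner ℝ (u : Eucl k) p
          ∂(unifSphere k) := by
    rw [meanGrad, real_inner_comm, ← integral_inner
      (continuous_gradEst hc hy).integrable_of_compactSpace, ← integral_const_mul]
    congr 1 with u
    rw [gradEst, real_inner_comm, real_inner_smul_left]
    ring
  have h2 : ∫ u : USphere k, f (y + δ • e (u : Eucl k)) * inner ℝ (u : Eucl k) p ∂(unifSphere k)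
      = - ∫ u : USphere k, f (y + δ • (u : Eucl k)) * inner ℝ (u : Eucl k) p ∂(unifSphere k) := by
    rw [← integral_sphereMap e (h := fun u : USphere k =>
      f (y + δ • (u : Eucl k)) * inner ℝ (u : Eucl k) p) (hf.mul (by fun_prop)),
      ← integral_neg]
    congr 1 with u
    simp [sphereMap, hrefl]
  simp_rw [sub_mul]
  have i1 : Integrable (fun u : USphere k => f (y + δ • (u : Eucl k)) * inner ℝ (u : Eucl k) p)
      (unifSphere k) := (hf.mul (by fun_prop)).integrable_of_compactSpace
  have i2 : Integrable (fun u : USphere k => f (y + δ • e (u : Eucl k)) * inner ℝ (u : Eucl k) p)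
      (unifSphere k) := (hfe.mul (by fun_prop)).integrable_of_compactSpace
  rw [integral_sub i1 i2, h1, h2]
  ring

lemma reflection_orthogonal_singleton (u : Eucl k) :
    u = (ℝ ∙ p)ᗮ.reflection u + (2 * inner ℝ u p / ‖p‖ ^ 2) • p := by
  rw [Submodule.reflection_orthogonal_apply, Submodule.reflection_singleton_apply,
    real_inner_comm]
  simp only [RCLike.ofReal_real_eq_id, id]
  module

lemma add_smul_eq_reflection_add (u : Eucl k) :
    y + δ • u = y + δ • (ℝ ∙ p)ᗮ.reflection u + (2 * δ * inner ℝ u p / ‖p‖ ^ 2) • p := by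
  conv_lhs => rw [reflection_orthogonal_singleton (p := p) u]
  module

/-- The two reflected points are `2δ|⟨u, p⟩| / ‖p‖` apart, so the integrand is at most a constant
times `⟨u, p⟩²`. The second moment `‖p‖² / k` cancels the factor `k / δ`, so the dimension
disappears from the bound. -/
lemma inner_meanGrad_le_mul_norm (hk : 1 ≤ k) (hδ : 0 < δ) (hc : ContinuousOn f K)
    (hL : ∀ a ∈ K, ∀ b ∈ K, |f a - f b| ≤ G * ‖a - b‖)
    (hy : ∀ u : USphere k, y + δ • (u : Eucl k) ∈ K) :
    inner ℝ (meanGrad f δ y) p ≤ G * ‖p‖ := by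
  rcases eq_or_ne p 0 with rfl | hp
  · simp
  have := isProbabilityMeasure_unifSphere hk
  have hp' : 0 < ‖p‖ := norm_pos_iff.2 hp
  have hk' : (0 : ℝ) < k := by positivity
  rw [inner_meanGrad hk hc hy]
  have hf := continuous_eval_add_smul hc hy
  have hfe : Continuous fun u : USphere k => f (y + δ • ((ℝ ∙ p)ᗮ.reflection (u : Eucl k))) :=
    hf.comp (continuous_sphereMap _)
  calc _ ≤ k / (2 * δ) * ∫ u : USphere k, (2 * δ * G / ‖p‖) * inner ℝ (u : Eucl k) p ^ 2
          ∂(unifSphere k) := by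
        refine mul_le_mul_of_nonneg_left (integral_mono
          ((hf.sub hfe).mul (by fun_prop)).integrable_of_compactSpace
          (Continuous.integrable_of_compactSpace (by fun_prop)) fun u => ?_) (by positivity)
        have h1 := hL _ (hy u) _ (hy (sphereMap (ℝ ∙ p)ᗮ.reflection u))
        simp only [sphereMap] at h1
        have h2 : y + δ • (u : Eucl k) - (y + δ • (ℝ ∙ p)ᗮ.reflection (u : Eucl k))
            = (2 * δ * inner ℝ (u : Eucl k) p / ‖p‖ ^ 2) • p :=
          sub_eq_of_eq_add' (add_smul_eq_reflection_add _)
        rw [h2, norm_smul, Real.norm_eq_abs] at h1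
        set a : ℝ := inner ℝ (u : Eucl k) p with ha
        calc _ ≤ |f (y + δ • (u : Eucl k))
              - f (y + δ • ((ℝ ∙ p)ᗮ.reflection (u : Eucl k)))| * |a| := by
              rw [← abs_mul]; exact le_abs_self _
          _ ≤ (G * (|2 * δ * a / ‖p‖ ^ 2| * ‖p‖)) * |a| := by gcongr
          _ = 2 * δ * G / ‖p‖ * a ^ 2 := by
              rw [abs_div, abs_mul, abs_of_pos (by positivity : 0 < 2 * δ),
                abs_of_pos (by positivity : 0 < ‖p‖ ^ 2), ← sq_abs a]
              field_simp
    _ = G * ‖p‖ := by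
        rw [integral_const_mul, integral_inner_sq_unifSphere hk]
        field_simp

lemma norm_meanGrad_le (hk : 1 ≤ k) (hδ : 0 < δ) (hG : 0 ≤ G) (hc : ContinuousOn f K)
    (hL : ∀ a ∈ K, ∀ b ∈ K, |f a - f b| ≤ G * ‖a - b‖)
    (hy : ∀ u : USphere k, y + δ • (u : Eucl k) ∈ K) : ‖meanGrad f δ y‖ ≤ G := by
  have h := inner_meanGrad_le_mul_norm (p := meanGrad f δ y) hk hδ hc hL hy
  rw [real_inner_self_eq_norm_sq] at h
  by_contra! hlt
  nlinarith [norm_nonneg (meanGrad f δ y)]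

/-- The mean gradient estimate at `y` is almost a subgradient of the convex function `f`. -/
lemma inner_meanGrad_le (hk : 1 ≤ k) (hδ : 0 < δ) (hG : 0 ≤ G) (hf : ConvexOn ℝ K f)
    (hc : ContinuousOn f K) (hL : ∀ a ∈ K, ∀ b ∈ K, |f a - f b| ≤ G * ‖a - b‖)
    (hyK : y ∈ K) (hpK : y + p ∈ K) (hy : ∀ u : USphere k, y + δ • (u : Eucl k) ∈ K)
    (hp : ∀ u : USphere k, y + p + δ • (u : Eucl k) ∈ K) :
    inner ℝ (meanGrad f δ y) p ≤ f (y + p) - f y + 4 * G * δ := by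
  by_cases hpδ : ‖p‖ < 2 * δ
  · have h1 := inner_meanGrad_le_mul_norm (p := p) hk hδ hc hL hy
    have h2 := (abs_le.1 (hL _ hpK _ hyK)).1
    rw [add_sub_cancel_left] at h2
    nlinarith
  push Not at hpδ
  have := isProbabilityMeasure_unifSphere hk
  have hp' : 0 < ‖p‖ := by linarith
  have hk' : (0 : ℝ) < k := by positivity
  have hslope : ∀ (u : USphere k) (θ : ℝ), 0 ≤ θ → θ ≤ 1 →
      f (y + δ • (u : Eucl k) + θ • p) - f (y + δ • (u : Eucl k))
        ≤ θ * (f (y + p) - f y + 2 * G * δ) := by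
    intro u θ h0 h1
    have hb := hy u
    have hbp := hp u
    have h2 := hf.2 hb hbp (sub_nonneg.2 h1) h0 (by ring)
    have h3 : (1 - θ) • (y + δ • (u : Eucl k)) + θ • (y + p + δ • (u : Eucl k))
        = y + δ • (u : Eucl k) + θ • p := by module
    have hn : ‖δ • (u : Eucl k)‖ = δ := by simp [norm_smul, abs_of_pos hδ]
    have h4 := (abs_le.1 (hL _ hbp _ hpK)).2
    have h5 := (abs_le.1 (hL _ hb _ hyK)).1
    rw [add_sub_cancel_left, hn] at h4 h5
    rw [h3] at h2
    simp only [smul_eq_mul] at h2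
    nlinarith
  rw [inner_meanGrad hk hc hy]
  have hfc := continuous_eval_add_smul hc hy
  have hfe : Continuous fun u : USphere k => f (y + δ • ((ℝ ∙ p)ᗮ.reflection (u : Eucl k))) :=
    hfc.comp (continuous_sphereMap _)
  set V := f (y + p) - f y + 2 * G * δ with hV
  calc _ ≤ k / (2 * δ) * ∫ u : USphere k, (2 * δ * V / ‖p‖ ^ 2) * inner ℝ (u : Eucl k) p ^ 2
          ∂(unifSphere k) := by
        refine mul_le_mul_of_nonneg_left (integral_mono
          ((hfc.sub hfe).mul (by fun_prop)).integrable_of_compactSpace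
          (Continuous.integrable_of_compactSpace (by fun_prop)) fun u => ?_) (by positivity)
        have hw := add_smul_eq_reflection_add (p := p) (y := y) (δ := δ) (u : Eucl k)
        set a : ℝ := inner ℝ (u : Eucl k) p with ha
        have hab : |a| ≤ ‖p‖ := by
          have := abs_real_inner_le_norm (u : Eucl k) p
          simpa using this
        set θ := 2 * δ * a / ‖p‖ ^ 2 with hθ
        have hθ1 : |θ| ≤ 1 := by
          rw [hθ, abs_div, abs_mul, abs_of_pos (by positivity : 0 < 2 * δ),
            abs_of_pos (by positivity : 0 < ‖p‖ ^ 2), div_le_one (by positivity)]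
          nlinarith
        have hrhs : 2 * δ * V / ‖p‖ ^ 2 * a ^ 2 = θ * V * a := by rw [hθ]; ring
        simp only
        rw [hrhs]
        -- The secant bound starts from whichever point of the pair makes the step along `p`
        -- nonnegative. In both cases multiplication by `a` gives the same upper bound, whatever the
        -- sign of `V`.
        rcases le_total 0 a with ha0 | ha0
        · refine mul_le_mul_of_nonneg_right ?_ ha0
          rw [hw]
          exact hslope (sphereMap (ℝ ∙ p)ᗮ.reflection u) θ (by positivity) (abs_le.1 hθ1).2
        · refine mul_le_mul_of_nonpos_right ?_ ha0
          have hw' : y + δ • (ℝ ∙ p)ᗮ.reflection (u : Eucl k)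
              = y + δ • (u : Eucl k) + (-θ) • p := by
            rw [hw]; module
          have hθ0 : θ ≤ 0 := by
            rw [hθ]
            exact div_nonpos_of_nonpos_of_nonneg (by nlinarith) (by positivity)
          have := hslope u (-θ) (by linarith) (by linarith [(abs_le.1 hθ1).1])
          rw [hw']
          linarith
    _ = V := by
        rw [integral_const_mul, integral_inner_sq_unifSphere hk]
        field_simp
    _ ≤ _ := by rw [hV]; nlinarith

end Estimate

end Sphere

/-! ### P-FTRL -/

section FTRL

variable {k : ℕ} {K : Set (Eucl k)}

lemma argminOn_spec {φ : Eucl k → ℝ} (h : ∃ z, z ∈ K ∧ IsMinOn φ K z) :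
    argminOn K φ ∈ K ∧ IsMinOn φ K (argminOn K φ) :=
  Classical.epsilon_spec (p := fun z => z ∈ K ∧ IsMinOn φ K z) h

/-- The loss vectors `c` and the weights `β` drive the iterates `z`, which are characterized by the
first-order optimality conditions of P-FTRL. -/
def IsProximalFTRL (K : Set (Eucl k)) (c : ℕ → Eucl k) (β : ℕ → ℝ) (z : ℕ → Eucl k) (n : ℕ) :
    Prop :=
  z n ∈ K ∧ ∀ w ∈ K, 0 ≤ inner ℝ (∑ m ∈ Finset.range n, (c m + β m • (z n - z m))) (w - z n)

/-- The P-FTRL objective after `n` steps. -/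
noncomputable def ftrlObjective (c : ℕ → Eucl k) (β : ℕ → ℝ) (z : ℕ → Eucl k) (n : ℕ)
    (x : Eucl k) : ℝ :=
  ∑ m ∈ Finset.range n, (inner ℝ (c m) x + β m * ‖z m - x‖ ^ 2 / 2)

/-- The objective is quadratic with scalar Hessian `∑ β`, so its Taylor expansion is exact. It
supplies both the first-order condition and the strong convexity used in the regret bound. -/
lemma ftrlObjective_sub (c : ℕ → Eucl k) (β : ℕ → ℝ) (z : ℕ → Eucl k) (n : ℕ) (x w : Eucl k) :
    ftrlObjective c β z n w - ftrlObjective c β z n x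
      = inner ℝ (∑ m ∈ Finset.range n, (c m + β m • (x - z m))) (w - x)
        + (∑ m ∈ Finset.range n, β m) * ‖w - x‖ ^ 2 / 2 := by
  unfold ftrlObjective
  rw [← Finset.sum_sub_distrib, sum_inner, Finset.sum_mul, Finset.sum_div,
    ← Finset.sum_add_distrib]
  refine Finset.sum_congr rfl fun m _ => ?_
  have h : ‖z m - w‖ ^ 2 = ‖z m - x‖ ^ 2 - 2 * inner ℝ (z m - x) (w - x) + ‖w - x‖ ^ 2 := by
    rw [← norm_sub_sq_real]
    congr 2
    abel
  rw [h, inner_add_left, real_inner_smul_left, inner_sub_right (c m),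
    ← neg_sub (z m) x, inner_neg_left]
  ring

lemma continuous_ftrlObjective (c : ℕ → Eucl k) (β : ℕ → ℝ) (z : ℕ → Eucl k) (n : ℕ) :
    Continuous (ftrlObjective c β z n) := by
  unfold ftrlObjective
  fun_prop

lemma inner_nonneg_of_isMinOn (hK : Convex ℝ K) {c : ℕ → Eucl k} {β : ℕ → ℝ} {z : ℕ → Eucl k}
    {n : ℕ} {x w : Eucl k} (hx : x ∈ K) (hw : w ∈ K)
    (hmin : IsMinOn (ftrlObjective c β z n) K x) :
    0 ≤ inner ℝ (∑ m ∈ Finset.range n, (c m + β m • (x - z m))) (w - x) := by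
  set a : ℝ := inner ℝ (∑ m ∈ Finset.range n, (c m + β m • (x - z m))) (w - x) with ha
  set b : ℝ := (∑ m ∈ Finset.range n, β m) * ‖w - x‖ ^ 2 / 2 with hb
  have key : ∀ θ : ℝ, 0 < θ → θ ≤ 1 → 0 ≤ a + θ * b := by
    intro θ h0 h1
    have hmem : x + θ • (w - x) ∈ K := hK.add_smul_sub_mem hx hw ⟨h0.le, h1⟩
    have h2 : ftrlObjective c β z n x ≤ ftrlObjective c β z n (x + θ • (w - x)) := hmin hmem
    have h3 := ftrlObjective_sub c β z n x (x + θ • (w - x))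
    rw [add_sub_cancel_left, real_inner_smul_right, norm_smul, Real.norm_eq_abs, mul_pow, sq_abs,
      ← ha] at h3
    have h4 : 0 ≤ θ * (a + θ * b) := by
      have : θ * (a + θ * b) = θ * a + (∑ m ∈ Finset.range n, β m) * (θ ^ 2 * ‖w - x‖ ^ 2) / 2 := by
        rw [hb]; ring
      linarith
    exact nonneg_of_mul_nonneg_right h4 h0
  by_contra! hneg
  have hbpos : 0 < b := by linarith [key 1 one_pos le_rfl]
  -- If the slope `a` were negative, the step `-a / (2b)` would make `a + θ * b` equal to `a / 2 <
  -- 0`. The case `θ = 1` of `key` makes `b` positive and this step admissible, so no sign of the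
  -- weights is needed.
  have hlt : 0 < -a / (2 * b) := div_pos (by linarith) (by linarith)
  have hb1 : -a / (2 * b) ≤ 1 := by
    rw [div_le_one (by linarith)]
    linarith [key 1 one_pos le_rfl]
  have := key _ hlt hb1
  have h5 : -a / (2 * b) * b = -a / 2 := by field_simp
  rw [h5] at this
  linarith

/-- The weight of the `m`-th proximal term, counting from `0`. -/
noncomputable def stepWeight (η : ℕ → ℝ) (m : ℕ) : ℝ := pftrlWeight η (m + 1)

lemma sum_stepWeight (η : ℕ → ℝ) (n : ℕ) :
    ∑ m ∈ Finset.range (n + 1), stepWeight η m = 1 / η (n + 1) := by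
  induction n with
  | zero => simp [stepWeight, pftrlWeight]
  | succ n ih =>
    rw [Finset.sum_range_succ, ih]
    simp [stepWeight, pftrlWeight]

lemma pftrlIterate_succ (z₁ : Eucl k) (η : ℕ → ℝ) (c : ℕ → Eucl k) (n : ℕ) :
    pftrlIterate K z₁ η c (n + 1)
      = argminOn K (ftrlObjective c (stepWeight η) (pftrlIterate K z₁ η c) (n + 1)) := by
  rw [pftrlIterate]
  congr 1
  funext z
  rw [ftrlObjective, ← Fin.sum_univ_eq_sum_range
    (fun m => inner ℝ (c m) z + stepWeight η m * ‖pftrlIterate K z₁ η c m - z‖ ^ 2 / 2) (n + 1)]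
  rfl

lemma isProximalFTRL_pftrlIterate (hK : IsCompact K) (hconv : Convex ℝ K) {z₁ : Eucl k}
    (hz₁ : z₁ ∈ K) (η : ℕ → ℝ) (c : ℕ → Eucl k) (n : ℕ) :
    IsProximalFTRL K c (stepWeight η) (pftrlIterate K z₁ η c) n := by
  cases n with
  | zero =>
    rw [IsProximalFTRL, pftrlIterate]
    exact ⟨hz₁, by simp⟩
  | succ n =>
    have hex := hK.exists_isMinOn ⟨z₁, hz₁⟩ (continuous_ftrlObjective c (stepWeight η)
      (pftrlIterate K z₁ η c) (n + 1)).continuousOn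
    obtain ⟨h1, h2⟩ := argminOn_spec hex
    rw [← pftrlIterate_succ] at h1 h2
    exact ⟨h1, fun w hw => inner_nonneg_of_isMinOn hconv h1 hw h2⟩

lemma pftrlIterate_congr (z₁ : Eucl k) (η : ℕ → ℝ) {c c' : ℕ → Eucl k} (n : ℕ)
    (h : ∀ m < n, c m = c' m) : pftrlIterate K z₁ η c n = pftrlIterate K z₁ η c' n := by
  induction n using Nat.strong_induction_on with
  | _ n ih =>
    cases n with
    | zero => rw [pftrlIterate, pftrlIterate]
    | succ n =>
      rw [pftrlIterate_succ, pftrlIterate_succ]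
      congr 1
      funext z
      refine Finset.sum_congr rfl fun m hm => ?_
      have hm' := Finset.mem_range.1 hm
      rw [h m hm', ih m hm' fun j hj => h j (hj.trans hm')]

/-! ### Pathwise regret and stability of P-FTRL. -/

section Deterministic

variable {c : ℕ → Eucl k} {β : ℕ → ℝ} {z : ℕ → Eucl k}

/-- The regret bound of P-FTRL. -/
lemma IsProximalFTRL.regret_le (h : ∀ n, IsProximalFTRL K c β z n) (N : ℕ)
    (hpos : ∀ n < N, 0 < ∑ m ∈ Finset.range (n + 1), β m) {x : Eucl k} (hx : x ∈ K) :
    ∑ n ∈ Finset.range N, inner ℝ (c n) (z n - x)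
      ≤ ∑ n ∈ Finset.range N, β n * ‖z n - x‖ ^ 2 / 2
        + ∑ n ∈ Finset.range N, ‖c n‖ ^ 2 / (2 * ∑ m ∈ Finset.range (n + 1), β m) := by
  have hmin : ∀ n, ∀ w ∈ K, ftrlObjective c β z n (z n)
      + (∑ m ∈ Finset.range n, β m) * ‖w - z n‖ ^ 2 / 2 ≤ ftrlObjective c β z n w := by
    intro n w hw
    have h1 := ftrlObjective_sub c β z n (z n) w
    have h2 := (h n).2 w hw
    linarith
  -- Follow-the-leader induction on the minimal value: adding a loss raises it by at least the loss
  -- at the old minimizer minus a stability term.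
  have hlow : ∀ n ≤ N, ∑ m ∈ Finset.range n, (inner ℝ (c m) (z m)
      - ‖c m‖ ^ 2 / (2 * ∑ j ∈ Finset.range (m + 1), β j)) ≤ ftrlObjective c β z n (z n) := by
    intro n hn
    induction n with
    | zero => simp [ftrlObjective]
    | succ n ih =>
      rw [Finset.sum_range_succ]
      have h1 := hmin n _ (h (n + 1)).1
      have h2 : ftrlObjective c β z (n + 1) (z (n + 1)) = ftrlObjective c β z n (z (n + 1))
          + (inner ℝ (c n) (z (n + 1)) + β n * ‖z n - z (n + 1)‖ ^ 2 / 2) := by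
        rw [ftrlObjective, Finset.sum_range_succ]
        rfl
      have hp := hpos n hn
      have h3 := ih (by lia)
      rw [Finset.sum_range_succ] at hp
      rw [Finset.sum_range_succ (fun m => β m)]
      -- The new proximal term is centred at `z n`, so it vanishes there and only adds curvature.
      -- This is why the stability term contains the weight sum up to and including `β n`.
      set A := ∑ m ∈ Finset.range n, β m + β n with hA
      have h4 : -(inner ℝ (c n) (z (n + 1) - z n)) ≤ ‖c n‖ * ‖z (n + 1) - z n‖ :=
        (neg_le_abs _).trans (abs_real_inner_le_norm _ _)
      rw [inner_sub_right] at h4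
      rw [norm_sub_rev (z n)] at h2
      set d := ‖z (n + 1) - z n‖
      have h5 : ‖c n‖ * d ≤ ‖c n‖ ^ 2 / (2 * A) + A * d ^ 2 / 2 := by
        have h6 : ‖c n‖ ^ 2 / (2 * A) + A * d ^ 2 / 2 - ‖c n‖ * d
            = (‖c n‖ - A * d) ^ 2 / (2 * A) := by field_simp; ring
        have : 0 ≤ (‖c n‖ - A * d) ^ 2 / (2 * A) := by positivity
        linarith
      have h7 : A * d ^ 2 / 2 = (∑ m ∈ Finset.range n, β m) * d ^ 2 / 2 + β n * d ^ 2 / 2 := by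
        rw [hA]; ring
      linarith
  have h1 := hlow N le_rfl
  have h2 := hmin N x hx
  have h3 : 0 ≤ (∑ m ∈ Finset.range N, β m) * ‖x - z N‖ ^ 2 / 2 := by
    cases N with
    | zero => simp
    | succ N =>
      have := hpos N (by lia)
      positivity
  have h4 : ftrlObjective c β z N x = ∑ n ∈ Finset.range N, inner ℝ (c n) x
      + ∑ n ∈ Finset.range N, β n * ‖z n - x‖ ^ 2 / 2 := by
    rw [ftrlObjective, Finset.sum_add_distrib]
  rw [Finset.sum_sub_distrib] at h1
  simp_rw [inner_sub_right]
  rw [Finset.sum_sub_distrib]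
  linarith

/-- Two P-FTRL iterates are close if the loss vectors revealed in between nearly cancel. -/
lemma IsProximalFTRL.mul_norm_sub_le (h : ∀ n, IsProximalFTRL K c β z n) (hβ : ∀ n, 0 ≤ β n)
    {n m : ℕ} (hnm : n ≤ m) :
    (∑ j ∈ Finset.range m, β j) * ‖z m - z n‖
      ≤ ‖∑ j ∈ Finset.Ico n m, c j‖ + ∑ j ∈ Finset.Ico n m, β j * ‖z j - z n‖ := by
  rcases eq_or_ne (z m) (z n) with heq | hne
  · rw [heq, sub_self, norm_zero, mul_zero]
    exact add_nonneg (norm_nonneg _)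
      (Finset.sum_nonneg fun j _ => mul_nonneg (hβ j) (norm_nonneg _))
  have hd : 0 < ‖z m - z n‖ := norm_pos_iff.2 (sub_ne_zero.2 hne)
  -- Each iterate is tested against the other one. The gradient at time `m`, recentred at `z n`, is
  -- the gradient at time `n` plus the increment `v` plus a strongly monotone part.
  have h1 := (h m).2 _ (h n).1
  have h2 := (h n).2 _ (h m).1
  set v := ∑ j ∈ Finset.Ico n m, c j + ∑ j ∈ Finset.Ico n m, β j • (z n - z j) with hv
  have hsum : ∑ j ∈ Finset.range m, (c j + β j • (z m - z j))
      = ∑ j ∈ Finset.range n, (c j + β j • (z n - z j)) + v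
        + (∑ j ∈ Finset.range m, β j) • (z m - z n) := by
    have h3 : ∑ j ∈ Finset.range m, (c j + β j • (z m - z j))
        = ∑ j ∈ Finset.range m, (c j + β j • (z n - z j))
          + (∑ j ∈ Finset.range m, β j) • (z m - z n) := by
      rw [Finset.sum_smul, ← Finset.sum_add_distrib]
      refine Finset.sum_congr rfl fun j _ => ?_
      module
    rw [h3, ← Finset.sum_range_add_sum_Ico _ hnm, hv, Finset.sum_add_distrib (s := Finset.Ico n m)]
  rw [hsum, ← neg_sub (z m) (z n), inner_neg_right, inner_add_left, inner_add_left,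
    real_inner_smul_left, real_inner_self_eq_norm_sq] at h1
  have h4 : -(inner ℝ v (z m - z n)) ≤ ‖v‖ * ‖z m - z n‖ :=
    (neg_le_abs _).trans (abs_real_inner_le_norm _ _)
  have h5 : (∑ j ∈ Finset.range m, β j) * ‖z m - z n‖ ≤ ‖v‖ := by
    refine le_of_mul_le_mul_right ?_ hd
    nlinarith
  refine h5.trans ((norm_add_le _ _).trans ?_)
  gcongr
  refine (norm_sum_le _ _).trans (Finset.sum_le_sum fun j _ => ?_)
  rw [norm_smul, Real.norm_eq_abs, abs_of_nonneg (hβ j), norm_sub_rev]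

/-- Solution of the linear recursion satisfied by the drift of P-FTRL. -/
lemma drift_recursion_le {β W : ℕ → ℝ} (hβ : ∀ j, 0 ≤ β j) {n : ℕ} {a b : ℝ} (ha : 0 ≤ a)
    (hb : 0 ≤ b) (hpos : ∀ j, n ≤ j → 0 < ∑ i ∈ Finset.range (j + 1), β i) (hW : W n = 0) {N : ℕ}
    (hrec : ∀ m, n < m → m ≤ N → (∑ j ∈ Finset.range m, β j) * W m
      ≤ a + b * (m - n : ℝ) + ∑ j ∈ Finset.Ico n m, β j * W j) {m : ℕ} (hnm : n ≤ m)
    (hmN : m ≤ N) :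
    W m ≤ a / (∑ i ∈ Finset.range (n + 1), β i)
      + ∑ j ∈ Finset.Ico n m, b / ∑ i ∈ Finset.range (j + 1), β i := by
  set A : ℕ → ℝ := fun m => ∑ j ∈ Finset.range m, β j with hA
  have hAs : ∀ m, A (m + 1) = A m + β m := fun m => Finset.sum_range_succ _ _
  set U : ℕ → ℝ := fun m => a / A (n + 1) + ∑ j ∈ Finset.Ico n m, b / A (j + 1) with hU
  have hU0 : ∀ m, 0 ≤ U m := fun m => add_nonneg (div_nonneg ha (hpos n le_rfl).le)
    (Finset.sum_nonneg fun j hj => div_nonneg hb (hpos j (Finset.mem_Ico.1 hj).1).le)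
  -- `U` is a supersolution of the recursion. At `n + 1` both sides equal `a + b`; the summand `j =
  -- n` is absent because `W n = 0`. From `m` to `m + 1` both sides grow by `β m * U m + b`, since
  -- the new term of `U` is `b / A (m + 1)`.
  have hUge : ∀ i : ℕ, a + b * (i + 1 : ℝ) + ∑ j ∈ Finset.Ico (n + 1) (n + 1 + i), β j * U j
      ≤ A (n + 1 + i) * U (n + 1 + i) := by
    intro i
    induction i with
    | zero =>
      have := hpos n le_rfl
      simp only [CharP.cast_eq_zero, zero_add, mul_one, add_zero, Finset.Ico_self,
        Finset.sum_empty, hU, Nat.Ico_succ_singleton, Finset.sum_singleton]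
      rw [← add_div, mul_div_cancel₀ _ (ne_of_gt this)]
    | succ i ih =>
      have hp := hpos (n + 1 + i) (by lia)
      have h1 : U (n + 1 + (i + 1)) = U (n + 1 + i) + b / A (n + 1 + i + 1) := by
        simp only [hU]
        rw [← add_assoc (n + 1) i 1, Finset.sum_Ico_succ_top (by lia)]
        ring
      have h2 : A (n + 1 + (i + 1)) * U (n + 1 + (i + 1))
          = A (n + 1 + i) * U (n + 1 + i) + β (n + 1 + i) * U (n + 1 + i) + b := by
        rw [h1, ← add_assoc (n + 1) i 1, mul_add, mul_div_cancel₀ _ (ne_of_gt hp), hAs]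
        ring
      rw [h2, ← add_assoc (n + 1) i 1, Finset.sum_Ico_succ_top (by lia)]
      push_cast
      linarith
  change W m ≤ U m
  induction m using Nat.strong_induction_on with
  | _ m ih =>
    rcases eq_or_lt_of_le hnm with rfl | hlt
    · rw [hW]; exact hU0 _
    obtain ⟨i, rfl⟩ := Nat.exists_eq_add_of_le hlt
    have hp : 0 < A (n + 1 + i) := by
      have := hpos (n + i) (by lia)
      rwa [show n + i + 1 = n + 1 + i by ring] at this
    have h1 := hrec _ hlt hmN
    rw [Finset.sum_eq_sum_Ico_succ_bot hlt, hW, mul_zero, zero_add] at h1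
    have h2 : ∑ j ∈ Finset.Ico (n + 1) (n + 1 + i), β j * W j
        ≤ ∑ j ∈ Finset.Ico (n + 1) (n + 1 + i), β j * U j := by
      refine Finset.sum_le_sum fun j hj => mul_le_mul_of_nonneg_left ?_ (hβ j)
      have hj' := Finset.mem_Ico.1 hj
      exact ih j hj'.2 (by lia) (by lia)
    have h3 := hUge i
    refine le_of_mul_le_mul_left ?_ hp
    change A (n + 1 + i) * W (n + 1 + i)
      ≤ a + b * (((n + 1 + i : ℕ) : ℝ) - n) + ∑ j ∈ Finset.Ico (n + 1) (n + 1 + i), β j * W j at h1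
    change A (n + 1 + i) * W (n + 1 + i) ≤ A (n + 1 + i) * U (n + 1 + i)
    have h4 : ((n + 1 + i : ℕ) : ℝ) - n = i + 1 := by push_cast; ring
    rw [h4] at h1
    linarith

end Deterministic

/-- Strong monotonicity makes the minimizer Lipschitz in the linear part `P` of the gradient.
Continuity in the directions settles all measurability and integrability questions, because the
space of directions is compact. -/
lemma continuous_pftrlIterate {X : Type*} [TopologicalSpace X] (hK : IsCompact K)
    (hconv : Convex ℝ K) {z₁ : Eucl k} (hz₁ : z₁ ∈ K) {η : ℕ → ℝ} (hη : ∀ n, 0 < η (n + 1))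
    {c : X → ℕ → Eucl k} (n : ℕ) (hc : ∀ m < n, Continuous fun x => c x m) :
    Continuous fun x => pftrlIterate K z₁ η (c x) n := by
  induction n using Nat.strong_induction_on with
  | _ n ih =>
    cases n with
    | zero => simp only [pftrlIterate]; exact continuous_const
    | succ n =>
      have hsum := sum_stepWeight η n
      have hpos : 0 < 1 / η (n + 1) := one_div_pos.2 (hη n)
      set P : X → Eucl k := fun x => ∑ m ∈ Finset.range (n + 1),
        (c x m - stepWeight η m • pftrlIterate K z₁ η (c x) m) with hP
      have hPc : Continuous P := by
        refine continuous_finsetSum _ fun m hm => ?_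
        have hm' := Finset.mem_range.1 hm
        have h := (ih m hm' fun j hj => hc j (hj.trans hm')).const_smul (stepWeight η m)
        exact (hc m hm').sub h
      have hgrad : ∀ x, ∑ m ∈ Finset.range (n + 1), (c x m + stepWeight η m •
          (pftrlIterate K z₁ η (c x) (n + 1) - pftrlIterate K z₁ η (c x) m))
          = P x + (1 / η (n + 1)) • pftrlIterate K z₁ η (c x) (n + 1) := by
        intro x
        rw [← hsum, hP, Finset.sum_smul, ← Finset.sum_add_distrib]
        refine Finset.sum_congr rfl fun m _ => ?_
        module
      have hLip : ∀ x y, ‖pftrlIterate K z₁ η (c x) (n + 1) - pftrlIterate K z₁ η (c y) (n + 1)‖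
          ≤ η (n + 1) * ‖P x - P y‖ := by
        intro x y
        obtain ⟨hx, hx'⟩ := isProximalFTRL_pftrlIterate hK hconv hz₁ η (c x) (n + 1)
        obtain ⟨hy, hy'⟩ := isProximalFTRL_pftrlIterate hK hconv hz₁ η (c y) (n + 1)
        have h1 := hx' _ hy
        have h2 := hy' _ hx
        rw [hgrad] at h1 h2
        set zx := pftrlIterate K z₁ η (c x) (n + 1)
        set zy := pftrlIterate K z₁ η (c y) (n + 1)
        rcases eq_or_ne zx zy with heq | hne
        · rw [heq, sub_self, norm_zero]
          have := hη n
          positivity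
        have hd : 0 < ‖zx - zy‖ := norm_pos_iff.2 (sub_ne_zero.2 hne)
        have h3 : (1 / η (n + 1)) * ‖zx - zy‖ ^ 2 ≤ - inner ℝ (P x - P y) (zx - zy) := by
          rw [← real_inner_self_eq_norm_sq]
          rw [← neg_sub zx zy, inner_neg_right, inner_add_left, real_inner_smul_left] at h1
          rw [inner_add_left, real_inner_smul_left] at h2
          have h4 : inner ℝ (zx - zy) (zx - zy) = inner ℝ zx (zx - zy) - inner ℝ zy (zx - zy) :=
            inner_sub_left _ _ _
          rw [h4, inner_sub_left]
          linarith
        have h5 : - inner ℝ (P x - P y) (zx - zy) ≤ ‖P x - P y‖ * ‖zx - zy‖ :=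
          (neg_le_abs _).trans (abs_real_inner_le_norm _ _)
        have h6 : (1 / η (n + 1)) * ‖zx - zy‖ ≤ ‖P x - P y‖ := by
          refine le_of_mul_le_mul_right ?_ hd
          linarith
        rw [one_div, inv_mul_le_iff₀ (hη n)] at h6
        exact h6
      rw [continuous_iff_continuousAt]
      intro x
      rw [ContinuousAt, tendsto_iff_norm_sub_tendsto_zero]
      refine squeeze_zero (fun _ => norm_nonneg _) (fun y => hLip y x) ?_
      have h7 := tendsto_iff_norm_sub_tendsto_zero.1 (hPc.continuousAt (x := x))
      simpa using h7.const_mul (η (n + 1))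

end FTRL

/-! ### Combinatorics of the timeline -/

section LowerSets

variable {T : ℕ}

/-- A downward closed subset of `Fin T` is an initial segment, hence determined by its size. This
translates counts of events before a given time into comparisons of indices. -/
lemma lt_card_filter_iff {P : Fin T → Prop} [DecidablePred P] (hP : ∀ i j, i ≤ j → P j → P i)
    (m : Fin T) : (m : ℕ) < (Finset.univ.filter P).card ↔ P m := by
  constructor
  · intro h
    by_contra hm
    have hsub : Finset.univ.filter P ⊆ Finset.Iio m := by
      intro j hj
      rw [Finset.mem_Iio]
      by_contra! hle
      exact hm (hP m j hle (Finset.mem_filter.1 hj).2)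
    have := Finset.card_le_card hsub
    rw [Fin.card_Iio] at this
    lia
  · intro h
    have hsub : Finset.Iic m ⊆ Finset.univ.filter P := by
      intro j hj
      exact Finset.mem_filter.2 ⟨Finset.mem_univ _, hP j m (Finset.mem_Iic.1 hj) h⟩
    have := Finset.card_le_card hsub
    rw [Fin.card_Iic] at this
    lia

lemma filter_lt_finRange (n : ℕ) :
    (List.finRange T).filter (fun m : Fin T => (m : ℕ) < n) = (List.finRange T).take n := by
  conv_lhs => rw [← List.take_append_drop n (List.finRange T), List.filter_append]
  rw [List.filter_eq_self.2, List.filter_eq_nil_iff.2, List.append_nil]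
  · intro a ha
    obtain ⟨i, hi, rfl⟩ := List.mem_drop_iff_getElem.1 ha
    simp
  · intro a ha
    obtain ⟨i, hi, rfl⟩ := List.mem_take_iff_getElem.1 ha
    simp at hi ⊢
    lia

lemma filter_lt_append_filter_eq {α : Type*} (g : α → ℕ) (n : ℕ) {L : List α}
    (hL : L.Pairwise fun a b => g a ≤ g b) :
    L.filter (fun a => g a < n) ++ L.filter (fun a => g a = n)
      = L.filter (fun a => g a < n + 1) := by
  induction L with
  | nil => simp
  | cons a L ih =>
    rw [List.pairwise_cons] at hL
    have ih := ih hL.2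
    rcases lt_trichotomy (g a) n with h | h | h
    · rw [List.filter_cons_of_pos (by simpa using h), List.filter_cons_of_neg (by simpa using h.ne),
        List.filter_cons_of_pos (by simp; lia), List.cons_append, ih]
    · have h0 : L.filter (fun a => g a < n) = [] := by
        rw [List.filter_eq_nil_iff]
        intro b hb
        have := hL.1 b hb
        simp
        lia
      rw [List.filter_cons_of_neg (by simp; lia), List.filter_cons_of_pos (by simpa using h),
        List.filter_cons_of_pos (by simp; lia), h0, ← ih, h0]
      simp
    · rw [List.filter_cons_of_neg (by simp; lia), List.filter_cons_of_neg (by simp; lia),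
        List.filter_cons_of_neg (by simp; lia), ih]

end LowerSets

namespace Timeline

variable {T : ℕ} (τ : Timeline T)

lemma strictMono_r_obsOrder : StrictMono (τ.r ∘ τ.obsOrder) :=
  (Tuple.monotone_sort τ.r).strictMono_of_injective (τ.r_injective.comp τ.obsOrder.injective)

/-- The position of the feedback of round `t` in the order of observation, counting from `0`. -/
noncomputable def obsPos (t : Fin T) : Fin T := τ.obsOrder.symm t

lemma obsOrder_obsPos (t : Fin T) : τ.obsOrder (τ.obsPos t) = t := by simp [obsPos]

lemma obsPos_obsOrder (m : Fin T) : τ.obsPos (τ.obsOrder m) = m := by simp [obsPos]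

lemma obsPos_lt_iff (s t : Fin T) : τ.obsPos s < τ.obsPos t ↔ τ.r s < τ.r t := by
  have := τ.strictMono_r_obsOrder.lt_iff_lt (a := τ.obsPos s) (b := τ.obsPos t)
  simpa [obsOrder_obsPos] using this.symm

/-- The number of observations received before time `x`. -/
noncomputable def obsCount (x : ℝ) : ℕ :=
  (Finset.univ.filter fun m => τ.r (τ.obsOrder m) < x).card

lemma lt_obsCount_iff (x : ℝ) (m : Fin T) : (m : ℕ) < τ.obsCount x ↔ τ.r (τ.obsOrder m) < x :=
  lt_card_filter_iff (fun _ _ hij hj => (τ.strictMono_r_obsOrder.monotone hij).trans_lt hj) m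

lemma obsCount_le (x : ℝ) : τ.obsCount x ≤ T :=
  (Finset.card_filter_le _ _).trans (by simp)

lemma obsCount_eq_card (x : ℝ) :
    τ.obsCount x = (Finset.univ.filter fun s => τ.r s < x).card :=
  Finset.card_equiv τ.obsOrder (by simp)

lemma obsPos_eq_obsCount (t : Fin T) : (τ.obsPos t : ℕ) = τ.obsCount (τ.r t) := by
  refine le_antisymm ?_ ?_
  · by_contra! h
    have := (τ.lt_obsCount_iff (τ.r t) ⟨τ.obsCount (τ.r t), h.trans (τ.obsPos t).2⟩).2 ?_
    · simp at this
    · rw [← τ.obsPos_lt_iff, obsPos_obsOrder]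
      exact h
  · by_contra! h
    have := (τ.lt_obsCount_iff _ _).1 h
    rw [obsOrder_obsPos] at this
    exact lt_irrefl _ this

/-- The number of observations received before the prediction of round `t`. -/
noncomputable def seen (t : Fin T) : ℕ := τ.obsCount (τ.l t)

lemma seen_le_obsPos (t : Fin T) : τ.seen t ≤ τ.obsPos t := by
  rw [obsPos_eq_obsCount, seen]
  refine Finset.card_le_card fun m hm => ?_
  have := (Finset.mem_filter.1 hm).2
  exact Finset.mem_filter.2 ⟨Finset.mem_univ _, this.trans (τ.l_lt_r t)⟩

/-- The predictions requested before `r s` are those of rounds up to `s` and those made while `s` is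
outstanding. Consequently feedback `s` arrives in the round with zero-based index `s + delay s`. -/
lemma card_l_lt (s : Fin T) :
    (Finset.univ.filter fun t => τ.l t < τ.r s).card = (s : ℕ) + 1 + τ.delay s := by
  classical
  have h : (Finset.univ.filter fun t => τ.l t < τ.r s)
      = Finset.Iic s ∪ Finset.univ.filter fun t => τ.l t ∈ τ.interval s := by
    ext t
    simp only [Finset.mem_filter, Finset.mem_univ, true_and, Finset.mem_union, Finset.mem_Iic,
      interval, Set.mem_Ioo, ← τ.l_strictMono.le_iff_le]
    constructor
    · intro h
      rcases le_or_gt (τ.l t) (τ.l s) with h' | h'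
      · exact Or.inl h'
      · exact Or.inr ⟨h', h⟩
    · rintro (h | h)
      · exact h.trans_lt (τ.l_lt_r s)
      · exact h.2
  rw [h, Finset.card_union_of_disjoint, Fin.card_Iic]
  · congr!
  · rw [Finset.disjoint_left]
    intro t h1 h2
    have h3 := (Finset.mem_filter.1 h2).2.1
    rw [τ.l_strictMono.lt_iff_lt] at h3
    exact absurd (Finset.mem_Iic.1 h1) (not_le.2 h3)

lemma lt_add_delay_iff (s t : Fin T) : (t : ℕ) < (s : ℕ) + 1 + τ.delay s ↔ τ.l t < τ.r s := by
  rw [← card_l_lt]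
  exact lt_card_filter_iff (fun i j hij hj => (τ.l_strictMono.monotone hij).trans_lt hj) t

lemma add_delay_lt_iff (s t : Fin T) : (s : ℕ) + τ.delay s < t ↔ τ.r s < τ.l t := by
  have h := (τ.lt_add_delay_iff s t).not
  rw [not_lt, not_lt] at h
  rw [lt_iff_le_and_ne (a := τ.r s), ← h]
  have := (τ.l_ne_r t s).symm
  constructor
  · intro h; exact ⟨by lia, this⟩
  · intro h; lia

lemma add_delay_lt (s : Fin T) : (s : ℕ) + τ.delay s < T := by
  have h := τ.card_l_lt s
  have := (Finset.card_filter_le (Finset.univ : Finset (Fin T)) fun t => τ.l t < τ.r s)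
  rw [Finset.card_univ, Fintype.card_fin] at this
  lia

lemma add_delay_obsOrder_lt_iff (m t : Fin T) :
    (τ.obsOrder m : ℕ) + τ.delay (τ.obsOrder m) < t ↔ (m : ℕ) < τ.seen t := by
  rw [add_delay_lt_iff, seen, lt_obsCount_iff]

lemma add_delay_mono {s t : Fin T} (h : τ.r s ≤ τ.r t) :
    (s : ℕ) + τ.delay s ≤ (t : ℕ) + τ.delay t := by
  have := Finset.card_le_card (s := Finset.univ.filter fun i => τ.l i < τ.r s)
    (t := Finset.univ.filter fun i => τ.l i < τ.r t) (fun i hi => by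
      simp only [Finset.mem_filter, Finset.mem_univ, true_and] at hi ⊢
      exact hi.trans_le h)
  rw [card_l_lt, card_l_lt] at this
  lia

/-- Apart from `t` itself, every prediction requested before `r t` has either been observed by then
or is still outstanding. Summing over `t`, and using that positions and indices are permutations of
each other, turns the total dual backlog into the total delay. -/
lemma dualBacklog_add_obsPos (t : Fin T) :
    τ.dualBacklog t + τ.obsPos t = (t : ℕ) + τ.delay t := by
  classical
  have h := τ.card_l_lt t
  have h1 : (Finset.univ.filter fun s => τ.l s < τ.r t)
      = insert t ((Finset.univ.filter fun s => τ.r s < τ.r t)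
        ∪ Finset.univ.filter fun s => τ.r t ∈ τ.interval s) := by
    ext s
    simp only [Finset.mem_filter, Finset.mem_univ, true_and, Finset.mem_union, Finset.mem_insert,
      interval, Set.mem_Ioo]
    constructor
    · intro h
      rcases lt_trichotomy (τ.r s) (τ.r t) with h' | h' | h'
      · exact Or.inr (Or.inl h')
      · exact Or.inl (τ.r_injective h')
      · exact Or.inr (Or.inr ⟨h, h'⟩)
    · rintro (rfl | h | h)
      · exact τ.l_lt_r s
      · exact (τ.l_lt_r s).trans h
      · exact h.1
  rw [h1, Finset.card_insert_of_notMem, Finset.card_union_of_disjoint, ← obsCount_eq_card,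
    ← obsPos_eq_obsCount] at h
  · have h2 : τ.dualBacklog t = (Finset.univ.filter fun s => τ.r t ∈ τ.interval s).card := by
      unfold dualBacklog; congr!
    rw [h2]
    lia
  · rw [Finset.disjoint_left]
    intro s h2 h3
    exact lt_asymm (Finset.mem_filter.1 h2).2 (Finset.mem_filter.1 h3).2.2
  · simp [interval]

lemma sum_dualBacklog : ∑ t, τ.dualBacklog t = τ.totalDelay := by
  have h : ∑ t, τ.dualBacklog t + ∑ t : Fin T, (τ.obsPos t : ℕ)
      = ∑ t : Fin T, (t : ℕ) + ∑ t, τ.delay t := by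
    rw [← Finset.sum_add_distrib, ← Finset.sum_add_distrib]
    exact Finset.sum_congr rfl fun t _ => τ.dualBacklog_add_obsPos t
  have h2 : ∑ t : Fin T, (τ.obsPos t : ℕ) = ∑ t : Fin T, (t : ℕ) :=
    Equiv.sum_comp τ.obsOrder.symm fun t : Fin T => (t : ℕ)
  rw [totalDelay]
  lia

/-- At the prediction of round `t`, each of the `t` earlier rounds is either seen or outstanding.
Summing the outstanding ones over `t` is double counting for the total delay. -/
lemma sum_seen_add_totalDelay : ∑ t, τ.seen t + τ.totalDelay = ∑ t : Fin T, (t : ℕ) := by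
  classical
  have h1 : τ.totalDelay
      = ∑ t, (Finset.univ.filter fun s => τ.l t ∈ τ.interval s).card := by
    rw [totalDelay]
    have : ∀ s, τ.delay s = (Finset.univ.filter fun t => τ.l t ∈ τ.interval s).card := fun s => by
      unfold delay; congr!
    simp_rw [this, Finset.card_filter]
    exact Finset.sum_comm
  rw [h1, ← Finset.sum_add_distrib]
  refine Finset.sum_congr rfl fun t _ => ?_
  rw [seen, obsCount_eq_card, ← Finset.card_union_of_disjoint, ← Fin.card_Iio t]
  · congr 1
    ext s
    simp only [Finset.mem_filter, Finset.mem_univ, true_and, Finset.mem_union, Finset.mem_Iio,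
      interval, Set.mem_Ioo, ← τ.l_strictMono.lt_iff_lt]
    constructor
    · rintro (h | h)
      · exact (τ.l_lt_r s).trans h
      · exact h.1
    · intro h
      rcases lt_or_gt_of_ne (τ.l_ne_r t s) with h' | h'
      · exact Or.inr ⟨h, h'⟩
      · exact Or.inl h'
  · rw [Finset.disjoint_left]
    intro s h2 h3
    exact lt_asymm (Finset.mem_filter.1 h2).2 (Finset.mem_filter.1 h3).2.2

lemma seen_le (t : Fin T) : τ.seen t ≤ t := by
  by_contra! h
  have h1 : (t : ℕ) < T := t.2
  have hall : ∀ m : Fin T, m ≤ t → τ.obsOrder m < t := by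
    intro m hm
    have := (τ.lt_obsCount_iff (τ.l t) m).1 (lt_of_le_of_lt hm h)
    rw [← τ.l_strictMono.lt_iff_lt]
    exact (τ.l_lt_r _).trans this
  have := Finset.card_le_card_of_injOn τ.obsOrder (s := Finset.Iic t) (t := Finset.Iio t)
    (fun m hm => Finset.mem_coe.2 (Finset.mem_Iio.2 (hall m (Finset.mem_Iic.1 hm))))
    τ.obsOrder.injective.injOn
  rw [Fin.card_Iic, Fin.card_Iio] at this
  lia

/-- Summing over the latency intervals the observations inside them counts every observation with
its dual backlog. -/
lemma sum_sum_Ico_seen_obsPos (h : ℕ → ℝ) :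
    ∑ t, ∑ m ∈ Finset.Ico (τ.seen t) (τ.obsPos t), h m
      = ∑ m : Fin T, τ.dualBacklog (τ.obsOrder m) * h m := by
  classical
  have h1 : ∀ t, ∑ m ∈ Finset.Ico (τ.seen t) (τ.obsPos t), h m
      = ∑ m : Fin T, if τ.r (τ.obsOrder m) ∈ τ.interval t then h m else 0 := by
    intro t
    have h2 : Finset.Ico (τ.seen t) (τ.obsPos t)
        = (Finset.range T).filter fun m => τ.seen t ≤ m ∧ m < τ.obsPos t := by
      ext m
      have := (τ.obsPos t).2
      simp only [Finset.mem_Ico, Finset.mem_filter, Finset.mem_range]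
      lia
    rw [h2, Finset.sum_filter, ← Fin.sum_univ_eq_sum_range
      (fun m => if τ.seen t ≤ m ∧ m < τ.obsPos t then h m else 0) T]
    refine Finset.sum_congr rfl fun m _ => ?_
    congr 1
    -- The `m`-th observation falls inside the latency interval of `t` exactly when its position
    -- lies in `[seen t, obsPos t)`. Exchanging the sums then counts the intervals around each
    -- observation.
    rw [eq_iff_iff, interval, Set.mem_Ioo, ← τ.obsPos_lt_iff, obsPos_obsOrder, ← not_lt, seen,
      lt_obsCount_iff, not_lt, Fin.lt_def]
    refine and_congr_left fun _ => ?_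
    exact (lt_iff_le_and_ne.trans (and_iff_left (τ.l_ne_r _ _))).symm
  simp_rw [h1]
  rw [Finset.sum_comm]
  refine Finset.sum_congr rfl fun m _ => ?_
  rw [← Finset.sum_filter, Finset.sum_const, nsmul_eq_mul]
  congr 2

end Timeline

/-! ### Structure of the wrapper -/

section WrapperStructure

variable {k T : ℕ} (B : OLOAlgorithm k) (r : ℝ) (δ : ℕ → ℝ) (τ : Timeline T)
  (f : Fin T → Eucl k → ℝ) (u : Fin T → USphere k)

lemma wrapperState_succ {n : ℕ} (h : n < T) : wrapperState B r δ τ f u (n + 1)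
    = wrapperRound B r δ τ f u ⟨n, h⟩ (wrapperState B r δ τ f u n) := by
  rw [wrapperState, dif_pos h]

lemma wrapperState_pred_eq {n : ℕ} (hn : n ≤ T) {t : Fin T} (ht : (t : ℕ) < n) :
    (wrapperState B r δ τ f u n).pred t = wrapperPred B r δ τ f u t := by
  rw [wrapperPred]
  induction hn using Nat.decreasingInduction with
  | self => rfl
  | of_succ m hm ih =>
    rw [← ih (by lia), wrapperState_succ B r δ τ f u hm, wrapperRound]
    simp only
    rw [Function.update_of_ne]
    intro h
    rw [h] at ht
    simp at ht

lemma wrapperPred_eq (t : Fin T) : wrapperPred B r δ τ f u t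
    = (1 - δ ((t : ℕ) + 1) / r) • B (wrapperState B r δ τ f u t).sent
      + δ ((t : ℕ) + 1) • (u t : Eucl k) := by
  rw [← wrapperState_pred_eq B r δ τ f u (n := t + 1) t.2 (by lia),
    wrapperState_succ B r δ τ f u t.2, wrapperRound]
  simp

/-- The loss vector of round `s` that the wrapper sends to the base algorithm. -/
noncomputable def wrapperLoss (s : Fin T) : Eucl k :=
  ((k : ℝ) / δ ((s : ℕ) + 1) * f s (wrapperPred B r δ τ f u s)) • (u s : Eucl k)

lemma wrapperState_sent {n : ℕ} (hn : n ≤ T) : (wrapperState B r δ τ f u n).sent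
    = (((List.finRange T).map τ.obsOrder).filter fun s : Fin T => (s : ℕ) + τ.delay s < n).map
        fun s => (wrapperLoss B r δ τ f u s, τ.dualDelay s, τ.dualBacklog s) := by
  induction n with
  | zero => simp [wrapperState]
  | succ n ih =>
    -- Arrival rounds are monotone in observation order, so the feedback of round `n` forms a block
    -- directly after everything sent before.
    have hsort : ((List.finRange T).map τ.obsOrder).Pairwise
        fun a b : Fin T => (a : ℕ) + τ.delay a ≤ (b : ℕ) + τ.delay b := by
      rw [List.pairwise_map]
      refine (List.pairwise_lt_finRange T).imp fun {a b} hab => ?_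
      exact τ.add_delay_mono (τ.strictMono_r_obsOrder hab).le
    rw [← filter_lt_append_filter_eq (fun s : Fin T => (s : ℕ) + τ.delay s) n hsort,
      List.map_append, ← ih (by lia), wrapperState_succ B r δ τ f u hn, wrapperRound]
    simp only
    congr 1
    rw [Timeline.observedIn]
    refine List.map_congr_left fun s hs => ?_
    have hs' := (List.mem_filter.1 hs).2
    simp only [decide_eq_true_eq] at hs'
    -- Feedback arriving in round `n` comes from a round `s ≤ n`, so the prediction of `s` already
    -- has its final value.
    have hx : (wrapperState B r δ τ f u (n + 1)).pred s = wrapperPred B r δ τ f u s :=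
      wrapperState_pred_eq B r δ τ f u hn (by lia)
    rw [wrapperState_succ B r δ τ f u hn, wrapperRound] at hx
    rw [wrapperLoss, ← hx]

/-- The loss vectors in the order of observation. -/
noncomputable def observedLoss (m : ℕ) : Eucl k :=
  if h : m < T then wrapperLoss B r δ τ f u (τ.obsOrder ⟨m, h⟩) else 0

end WrapperStructure

/-! ### P-FTRL inside the wrapper, indexed by observations. -/

section WrapperFTRL

variable {k T : ℕ} (K : Set (Eucl k)) (z₁ : Eucl k) (η : ℕ → ℝ) (r : ℝ) (δ : ℕ → ℝ)
  (τ : Timeline T) (f : Fin T → Eucl k → ℝ) (u : Fin T → USphere k)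

/-- The iterates of P-FTRL inside the wrapper. -/
noncomputable def wrapperIterate (n : ℕ) : Eucl k :=
  pftrlIterate K z₁ η (observedLoss (pftrl K z₁ η) r δ τ f u) n

lemma pftrl_wrapperState_sent (t : Fin T) :
    pftrl K z₁ η (wrapperState (pftrl K z₁ η) r δ τ f u t).sent
      = wrapperIterate K z₁ η r δ τ f u (τ.seen t) := by
  have hlist : ((List.finRange T).map τ.obsOrder).filter
      (fun s : Fin T => (s : ℕ) + τ.delay s < t)
      = ((List.finRange T).take (τ.seen t)).map τ.obsOrder := by
    rw [List.filter_map, ← filter_lt_finRange]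
    congr 2
    funext m
    simp only [Function.comp, τ.add_delay_obsOrder_lt_iff]
  have hle : τ.seen t ≤ T := τ.obsCount_le _
  rw [wrapperState_sent _ _ _ _ _ _ t.2.le, hlist, pftrl, wrapperIterate]
  simp only [List.length_map, List.length_take, List.length_finRange, min_eq_left hle]
  refine pftrlIterate_congr _ _ _ fun m hm => ?_
  have hmT : m < T := hm.trans_le hle
  rw [observedLoss, dif_pos hmT, List.getD_eq_getElem _ _ (by simp [hm, hmT])]
  simp

lemma wrapperPred_pftrl (t : Fin T) : wrapperPred (pftrl K z₁ η) r δ τ f u t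
    = (1 - δ ((t : ℕ) + 1) / r) • wrapperIterate K z₁ η r δ τ f u (τ.seen t)
      + δ ((t : ℕ) + 1) • (u t : Eucl k) := by
  rw [wrapperPred_eq, pftrl_wrapperState_sent]

lemma wrapperLoss_pftrl (t : Fin T) : wrapperLoss (pftrl K z₁ η) r δ τ f u t
    = gradEst (f t) (δ ((t : ℕ) + 1))
        ((1 - δ ((t : ℕ) + 1) / r) • wrapperIterate K z₁ η r δ τ f u (τ.seen t)) (u t) := by
  rw [wrapperLoss, wrapperPred_pftrl, gradEst]

/-- Up to the observation of round `t`, the iterates do not depend on the direction `u_t`. -/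
lemma wrapperIterate_update (t : Fin T) (v : USphere k) {n : ℕ} (hn : n ≤ τ.obsPos t) :
    wrapperIterate K z₁ η r δ τ f (Function.update u t v) n
      = wrapperIterate K z₁ η r δ τ f u n := by
  induction n using Nat.strong_induction_on with
  | _ n ih =>
    refine pftrlIterate_congr _ _ _ fun m hm => ?_
    have hmT : m < T := by have := (τ.obsPos t).2; lia
    rw [observedLoss, observedLoss, dif_pos hmT, dif_pos hmT, wrapperLoss_pftrl, wrapperLoss_pftrl]
    set s := τ.obsOrder ⟨m, hmT⟩ with hs
    have hps : (τ.obsPos s : ℕ) = m := by rw [hs, τ.obsPos_obsOrder]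
    have hst : s ≠ t := by
      rintro h
      rw [← h] at hn
      lia
    have hseen := τ.seen_le_obsPos s
    -- The loss at position `m` depends on `u` only through `u s`, with `s ≠ t`, and through the
    -- iterate `seen s`, whose index is at most `m < n`.
    rw [ih (τ.seen s) (by lia) (by lia), Function.update_of_ne hst]

end WrapperFTRL

/-! ### Resampling one coordinate of a product measure -/

section Resample

variable {ι X : Type*} [Fintype ι] [DecidableEq ι] [MeasurableSpace X] (ν : Measure X)
  [IsProbabilityMeasure ν]

lemma measurePreserving_update (i : ι) :
    MeasurePreserving (fun p : (ι → X) × X => Function.update p.1 i p.2)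
      ((Measure.pi fun _ => ν).prod ν) (Measure.pi fun _ => ν) := by
  have hm : Measurable fun p : (ι → X) × X => Function.update p.1 i p.2 := by
    refine measurable_pi_lambda _ fun j => ?_
    rcases eq_or_ne j i with rfl | hj
    · simpa using measurable_snd
    · simp only [Function.update_of_ne hj]
      exact (measurable_pi_apply j).comp measurable_fst
  refine ⟨hm, (Measure.pi_eq fun s hs => ?_).symm⟩
  rw [Measure.map_apply hm (MeasurableSet.univ_pi hs)]
  have hpre : (fun p : (ι → X) × X => Function.update p.1 i p.2) ⁻¹' (Set.univ.pi s)
      = (Set.univ.pi (Function.update s i Set.univ)) ×ˢ s i := by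
    ext p
    simp only [Set.mem_preimage, Set.mem_pi, Set.mem_univ, true_implies, Set.mem_prod]
    constructor
    · intro h
      refine ⟨fun j => ?_, by simpa using h i⟩
      rcases eq_or_ne j i with rfl | hj
      · simp
      · simpa [Function.update_of_ne hj] using h j
    · rintro ⟨h1, h2⟩ j
      rcases eq_or_ne j i with rfl | hj
      · simpa using h2
      · simpa [Function.update_of_ne hj] using h1 j
  rw [hpre, Measure.prod_prod, Measure.pi_pi, ← Finset.prod_erase_mul _ _ (Finset.mem_univ i),
    ← Finset.prod_erase_mul (Finset.univ : Finset ι) (fun j => ν (s j)) (Finset.mem_univ i)]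
  simp only [Function.update_self, measure_univ, mul_one]
  congr 1
  refine Finset.prod_congr rfl fun j hj => ?_
  rw [Function.update_of_ne (Finset.ne_of_mem_erase hj)]

/-- This is Fubini in the form of resampling one coordinate. It replaces conditional expectations in
the arguments below. -/
lemma integral_pi_eq_integral_update {E : Type*} [NormedAddCommGroup E] [NormedSpace ℝ E] (i : ι)
    {F : (ι → X) → E} (hF : Integrable F (Measure.pi fun _ => ν)) :
    ∫ x, F x ∂(Measure.pi fun _ => ν)
      = ∫ x, ∫ v, F (Function.update x i v) ∂ν ∂(Measure.pi fun _ => ν) := by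
  have hmp := measurePreserving_update ν i
  conv_lhs => rw [← hmp.map_eq]
  rw [integral_map hmp.measurable.aemeasurable
    (by rw [hmp.map_eq]; exact hF.aestronglyMeasurable)]
  exact integral_prod _ (hmp.integrable_comp_of_integrable hF)

end Resample

/-! ### The wrapper under random directions -/

lemma continuous_gradEst_comp {X : Type*} [TopologicalSpace X] {k : ℕ} {K : Set (Eucl k)}
    {f : Eucl k → ℝ} {δ : ℝ} {y : X → Eucl k} {v : X → USphere k} (hc : ContinuousOn f K)
    (hy : Continuous y) (hv : Continuous v) (hmem : ∀ x, y x + δ • (v x : Eucl k) ∈ K) :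
    Continuous fun x => gradEst f δ (y x) (v x) := by
  have hv' : Continuous fun x => (v x : Eucl k) := continuous_subtype_val.comp hv
  have h : Continuous fun x => f (y x + δ • (v x : Eucl k)) :=
    hc.comp_continuous (by fun_prop) hmem
  exact (continuous_const.mul h).smul hv'

lemma continuous_meanGrad_comp {X : Type*} [TopologicalSpace X] [FirstCountableTopology X]
    [LocallyCompactSpace X] {k : ℕ} (hk : 1 ≤ k) {K : Set (Eucl k)}
    {f : Eucl k → ℝ} {δ : ℝ} {y : X → Eucl k} (hc : ContinuousOn f K)
    (hy : Continuous y) (hmem : ∀ x, ∀ v : USphere k, y x + δ • (v : Eucl k) ∈ K) :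
    Continuous fun x => meanGrad f δ (y x) := by
  have := isProbabilityMeasure_unifSphere hk
  have h : Continuous (Function.uncurry fun (x : X) (v : USphere k) => gradEst f δ (y x) v) :=
    continuous_gradEst_comp (X := X × USphere k) hc (hy.comp continuous_fst) continuous_snd
      fun p => hmem p.1 p.2
  have := continuous_parametric_integral_of_continuous (μ := unifSphere k) h isCompact_univ
  simpa [meanGrad] using this

/-- The conditional mean of the loss vector of round `t`. -/
noncomputable def wrapperMeanLoss {k T : ℕ} (K : Set (Eucl k)) (z₁ : Eucl k) (η : ℕ → ℝ) (r : ℝ)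
    (δ : ℕ → ℝ) (τ : Timeline T) (f : Fin T → Eucl k → ℝ) (u : Fin T → USphere k) (t : Fin T) :
    Eucl k :=
  meanGrad (f t) (δ ((t : ℕ) + 1))
    ((1 - δ ((t : ℕ) + 1) / r) • wrapperIterate K z₁ η r δ τ f u (τ.seen t))

/-- The standing assumptions on domain, losses, smoothing radii and learning rates. -/
structure WrapperAssumptions {k T : ℕ} (K : Set (Eucl k)) (z₁ : Eucl k) (η : ℕ → ℝ) (r : ℝ)
    (δ : ℕ → ℝ) (f : Fin T → Eucl k → ℝ) (D G M : ℝ) : Prop where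
  one_le_k : 1 ≤ k
  compact : IsCompact K
  convex : Convex ℝ K
  start_mem : z₁ ∈ K
  r_pos : 0 < r
  ball_subset : Metric.closedBall 0 r ⊆ K
  diam_le : ∀ x ∈ K, ∀ y ∈ K, ‖x - y‖ ≤ D
  rate_pos : ∀ n, 0 < η (n + 1)
  weight_nonneg : ∀ n, 0 ≤ stepWeight η n
  delta_pos : ∀ t : Fin T, 0 < δ ((t : ℕ) + 1)
  delta_le : ∀ t : Fin T, δ ((t : ℕ) + 1) ≤ r
  G_pos : 0 < G
  loss_convex : ∀ t, ConvexOn ℝ K (f t)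
  loss_lipschitz : ∀ t, ∀ a ∈ K, ∀ b ∈ K, |f t a - f t b| ≤ G * ‖a - b‖
  loss_bounded : ∀ t, ∀ x ∈ K, |f t x| ≤ M

namespace WrapperAssumptions

variable {k T : ℕ} {K : Set (Eucl k)} {z₁ : Eucl k} {η : ℕ → ℝ} {r : ℝ} {δ : ℕ → ℝ}
  {f : Fin T → Eucl k → ℝ} {D G M : ℝ} (τ : Timeline T)

lemma loss_continuousOn (H : WrapperAssumptions K z₁ η r δ f D G M)
    (t : Fin T) : ContinuousOn (f t) K := by
  have : LipschitzOnWith ⟨G, H.G_pos.le⟩ (f t) K :=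
    LipschitzOnWith.of_dist_le_mul fun a ha b hb => by
      rw [Real.dist_eq, dist_eq_norm]
      exact H.loss_lipschitz t a ha b hb
  exact this.continuousOn

lemma isProbabilityMeasure_directionLaw (H : WrapperAssumptions K z₁ η r δ f D G M) :
    IsProbabilityMeasure (directionLaw k T) := by
  have := isProbabilityMeasure_unifSphere H.one_le_k
  unfold directionLaw
  infer_instance

lemma zero_mem (H : WrapperAssumptions K z₁ η r δ f D G M) : (0 : Eucl k) ∈ K :=
  H.ball_subset (by simp [H.r_pos.le])

lemma shrink_add_mem (H : WrapperAssumptions K z₁ η r δ f D G M)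
    (t : Fin T) {z : Eucl k} (hz : z ∈ K) (v : USphere k) :
    (1 - δ ((t : ℕ) + 1) / r) • z + δ ((t : ℕ) + 1) • (v : Eucl k) ∈ K := by
  have hr := H.r_pos
  have hv : r • (v : Eucl k) ∈ K := H.ball_subset (by simp [norm_smul, abs_of_pos hr])
  have h1 : δ ((t : ℕ) + 1) / r ≤ 1 := (div_le_one hr).2 (H.delta_le t)
  have h2 := H.convex hz hv (sub_nonneg.2 h1) (div_nonneg (H.delta_pos t).le hr.le) (by ring)
  rwa [smul_smul, div_mul_cancel₀ _ hr.ne'] at h2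

lemma shrink_mem (H : WrapperAssumptions K z₁ η r δ f D G M)
    (t : Fin T) {z : Eucl k} (hz : z ∈ K) :
    (1 - δ ((t : ℕ) + 1) / r) • z ∈ K := by
  have hr := H.r_pos
  have h1 : δ ((t : ℕ) + 1) / r ≤ 1 := (div_le_one hr).2 (H.delta_le t)
  have h2 := H.convex hz H.zero_mem (sub_nonneg.2 h1)
    (div_nonneg (H.delta_pos t).le hr.le) (by ring)
  simpa using h2

lemma isProximalFTRL (H : WrapperAssumptions K z₁ η r δ f D G M)
    (u : Fin T → USphere k) (n : ℕ) :
    IsProximalFTRL K (observedLoss (pftrl K z₁ η) r δ τ f u) (stepWeight η)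
      (wrapperIterate K z₁ η r δ τ f u) n :=
  isProximalFTRL_pftrlIterate H.compact H.convex H.start_mem _ _ n

lemma iterate_mem (H : WrapperAssumptions K z₁ η r δ f D G M)
    (u : Fin T → USphere k) (n : ℕ) : wrapperIterate K z₁ η r δ τ f u n ∈ K :=
  (H.isProximalFTRL τ u n).1

lemma pred_mem (H : WrapperAssumptions K z₁ η r δ f D G M)
    (u : Fin T → USphere k) (t : Fin T) :
    wrapperPred (pftrl K z₁ η) r δ τ f u t ∈ K := by
  rw [wrapperPred_pftrl]
  exact H.shrink_add_mem t (H.iterate_mem τ u _) _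

lemma continuous_iterate (H : WrapperAssumptions K z₁ η r δ f D G M)
    (n : ℕ) : Continuous fun u => wrapperIterate K z₁ η r δ τ f u n := by
  induction n using Nat.strong_induction_on with
  | _ n ih =>
    refine continuous_pftrlIterate H.compact H.convex H.start_mem H.rate_pos n fun m hm => ?_
    simp only [observedLoss]
    split_ifs with hmT
    · simp only [wrapperLoss_pftrl]
      have hseen := τ.seen_le_obsPos (τ.obsOrder ⟨m, hmT⟩)
      rw [τ.obsPos_obsOrder] at hseen
      have hz := ih (τ.seen (τ.obsOrder ⟨m, hmT⟩)) (lt_of_le_of_lt hseen hm)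
      have hz' := hz.const_smul (1 - δ ((τ.obsOrder ⟨m, hmT⟩ : ℕ) + 1) / r)
      exact continuous_gradEst_comp (H.loss_continuousOn _) hz'
        (continuous_apply _) fun u => H.shrink_add_mem _ (H.iterate_mem τ u _) _
    · exact continuous_const

lemma continuous_shrink_iterate (H : WrapperAssumptions K z₁ η r δ f D G M)
    (t : Fin T) : Continuous fun u =>
    (1 - δ ((t : ℕ) + 1) / r) • wrapperIterate K z₁ η r δ τ f u (τ.seen t) := by
  have h := (H.continuous_iterate τ (τ.seen t)).const_smul (1 - δ ((t : ℕ) + 1) / r)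
  exact h

lemma continuous_pred (H : WrapperAssumptions K z₁ η r δ f D G M)
    (t : Fin T) :
    Continuous fun u => wrapperPred (pftrl K z₁ η) r δ τ f u t := by
  simp only [wrapperPred_pftrl]
  have h2 : Continuous fun u : Fin T → USphere k => δ ((t : ℕ) + 1) • (u t : Eucl k) := by fun_prop
  exact (H.continuous_shrink_iterate τ t).add h2

lemma continuous_regret (H : WrapperAssumptions K z₁ η r δ f D G M)
    (x : Eucl k) :
    Continuous fun u => wrapperRegret (pftrl K z₁ η) r δ τ f u x := by
  unfold wrapperRegret
  refine continuous_finsetSum _ fun t _ => ?_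
  exact ((H.loss_continuousOn t).comp_continuous (H.continuous_pred τ t)
    fun u => H.pred_mem τ u t).sub continuous_const

lemma continuous_loss (H : WrapperAssumptions K z₁ η r δ f D G M)
    (t : Fin T) :
    Continuous fun u => wrapperLoss (pftrl K z₁ η) r δ τ f u t := by
  simp only [wrapperLoss_pftrl]
  exact continuous_gradEst_comp (H.loss_continuousOn _) (H.continuous_shrink_iterate τ t)
    (continuous_apply _) fun u => H.shrink_add_mem _ (H.iterate_mem τ u _) _

lemma continuous_meanLoss (H : WrapperAssumptions K z₁ η r δ f D G M)
    (t : Fin T) :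
    Continuous fun u => wrapperMeanLoss K z₁ η r δ τ f u t :=
  continuous_meanGrad_comp H.one_le_k (H.loss_continuousOn _) (H.continuous_shrink_iterate τ t)
    fun u v => H.shrink_add_mem _ (H.iterate_mem τ u _) v

lemma norm_meanLoss_le (H : WrapperAssumptions K z₁ η r δ f D G M)
    (u : Fin T → USphere k) (t : Fin T) :
    ‖wrapperMeanLoss K z₁ η r δ τ f u t‖ ≤ G :=
  norm_meanGrad_le H.one_le_k (H.delta_pos t) H.G_pos.le (H.loss_continuousOn t)
    (H.loss_lipschitz t) fun v => H.shrink_add_mem t (H.iterate_mem τ u _) v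

lemma norm_loss_le (H : WrapperAssumptions K z₁ η r δ f D G M)
    (u : Fin T → USphere k) (t : Fin T) :
    ‖wrapperLoss (pftrl K z₁ η) r δ τ f u t‖ ≤ k * M / δ ((t : ℕ) + 1) := by
  rw [wrapperLoss_pftrl]
  exact norm_gradEst_le (H.delta_pos t) (H.loss_bounded t)
    (H.shrink_add_mem t (H.iterate_mem τ u _) _)

/-- The loss vector of round `t` may be replaced by its conditional mean against any vector that
does not depend on the direction `u_t`. -/
lemma integral_inner_loss (H : WrapperAssumptions K z₁ η r δ f D G M)
    (t : Fin T) {h : (Fin T → USphere k) → Eucl k} (hh : Continuous h)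
    (hu : ∀ u v, h (Function.update u t v) = h u) :
    ∫ u, inner ℝ (wrapperLoss (pftrl K z₁ η) r δ τ f u t) (h u) ∂(directionLaw k T)
      = ∫ u, inner ℝ (wrapperMeanLoss K z₁ η r δ τ f u t) (h u) ∂(directionLaw k T) := by
  have := isProbabilityMeasure_unifSphere H.one_le_k
  have hcont : Continuous fun u => inner ℝ (wrapperLoss (pftrl K z₁ η) r δ τ f u t) (h u) :=
    (H.continuous_loss τ t).inner hh
  rw [directionLaw, integral_pi_eq_integral_update (unifSphere k) t
    hcont.integrable_of_compactSpace]
  congr 1 with u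
  simp only [hu, wrapperLoss_pftrl, wrapperIterate_update K z₁ η r δ τ f u t _
    (τ.seen_le_obsPos t), Function.update_self]
  rw [wrapperMeanLoss, meanGrad, real_inner_comm, ← integral_inner]
  · simp only [real_inner_comm]
  · exact (continuous_gradEst (H.loss_continuousOn t)
      fun v => H.shrink_add_mem t (H.iterate_mem τ u _) v).integrable_of_compactSpace

end WrapperAssumptions

/-! ### From regret in one round to expected total regret. -/

namespace WrapperAssumptions

variable {k T : ℕ} {K : Set (Eucl k)} {z₁ : Eucl k} {η : ℕ → ℝ} {r : ℝ} {δ : ℕ → ℝ}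
  {f : Fin T → Eucl k → ℝ} {D G M : ℝ} (τ : Timeline T)

lemma two_mul_r_le (H : WrapperAssumptions K z₁ η r δ f D G M) : 2 * r ≤ D := by
  have hr := H.r_pos
  set e : Eucl k := EuclideanSpace.single ⟨0, H.one_le_k⟩ r
  have he : ‖e‖ = r := by simp [e, abs_of_pos hr]
  have h1 : e ∈ K := H.ball_subset (by simp [he])
  have h2 : -e ∈ K := H.ball_subset (by simp [he])
  have h3 := H.diam_le _ h1 _ h2
  rwa [sub_neg_eq_add, ← two_smul ℝ e, norm_smul, he, Real.norm_eq_abs, abs_two] at h3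

lemma D_pos (H : WrapperAssumptions K z₁ η r δ f D G M) : 0 < D := by
  linarith [H.two_mul_r_le, H.r_pos]

/-- The regret of a round is controlled by the linearized regret of the base iterate. -/
lemma round_regret_le (H : WrapperAssumptions K z₁ η r δ f D G M)
    (u : Fin T → USphere k) (t : Fin T) {x : Eucl k} (hx : x ∈ K) :
    f t (wrapperPred (pftrl K z₁ η) r δ τ f u t) - f t x
      ≤ inner ℝ (wrapperMeanLoss K z₁ η r δ τ f u t)
          (wrapperIterate K z₁ η r δ τ f u (τ.seen t) - x)
        + 7 * (G * D) * (δ ((t : ℕ) + 1) / r) := by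
  have hr := H.r_pos
  have hG := H.G_pos
  have hD := H.two_mul_r_le
  have hδ := H.delta_pos t
  set z := wrapperIterate K z₁ η r δ τ f u (τ.seen t) with hz
  have hzK : z ∈ K := H.iterate_mem τ u _
  set a := δ ((t : ℕ) + 1) / r with ha
  have ha0 : 0 ≤ a := div_nonneg hδ.le hr.le
  have ha1 : a ≤ 1 := (div_le_one hr).2 (H.delta_le t)
  have hδa : δ ((t : ℕ) + 1) = a * r := by rw [ha, div_mul_cancel₀ _ hr.ne']
  set g := wrapperMeanLoss K z₁ η r δ τ f u t with hg
  have hadd : (1 - a) • z + (1 - a) • (x - z) = (1 - a) • x := by module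
  have h1 : inner ℝ g ((1 - a) • (x - z)) ≤ f t ((1 - a) • x) - f t ((1 - a) • z)
      + 4 * G * δ ((t : ℕ) + 1) := by
    have := inner_meanGrad_le (y := (1 - a) • z) (p := (1 - a) • (x - z)) H.one_le_k hδ hG.le
      (H.loss_convex t) (H.loss_continuousOn t) (H.loss_lipschitz t) (H.shrink_mem t hzK)
      (by rw [hadd]; exact H.shrink_mem t hx) (fun v => H.shrink_add_mem t hzK v)
      (fun v => by rw [hadd]; exact H.shrink_add_mem t hx v)
    rwa [hadd] at this
  have h2 := (abs_le.1 (H.loss_lipschitz t _ (H.pred_mem τ u t) _ (H.shrink_mem t hzK))).2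
  have h3 := (abs_le.1 (H.loss_lipschitz t _ (H.shrink_mem t hx) _ hx)).2
  rw [wrapperPred_pftrl, ← hz, ← ha, add_sub_cancel_left, norm_smul, Real.norm_eq_abs,
    abs_of_pos hδ, norm_eq_of_mem_sphere, mul_one] at h2
  rw [wrapperPred_pftrl, ← hz, ← ha]
  have hxD : ‖x‖ ≤ D := by simpa using H.diam_le _ hx _ H.zero_mem
  have h4 : ‖(1 - a) • x - x‖ ≤ a * D := by
    rw [show (1 - a) • x - x = -(a • x) by module, norm_neg, norm_smul, Real.norm_eq_abs,
      abs_of_nonneg ha0]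
    gcongr
  -- This bound removes the factor `1 - a` from the linear term at the price of `a * G * D`.
  -- Together with the shrinking of `x`, also `a * G * D`, and five errors `G * δ ≤ a * G * D` from
  -- smoothing and perturbation, it gives the constant 7.
  have h5 : |inner ℝ g (z - x)| ≤ G * D :=
    (abs_real_inner_le_norm _ _).trans (mul_le_mul (H.norm_meanLoss_le τ u t)
      (H.diam_le _ hzK _ hx) (norm_nonneg _) hG.le)
  rw [real_inner_smul_right, ← neg_sub z x, inner_neg_right] at h1
  have h6 := neg_le_of_abs_le h5
  have h7 : G * ‖(1 - a) • x - x‖ ≤ G * (a * D) := by gcongr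
  have h8 : G * δ ((t : ℕ) + 1) ≤ G * (a * D) := by
    rw [hδa]
    gcongr
    linarith
  nlinarith

lemma integrable_regret (H : WrapperAssumptions K z₁ η r δ f D G M)
    (x : Eucl k) :
    Integrable (fun u => wrapperRegret (pftrl K z₁ η) r δ τ f u x) (directionLaw k T) := by
  have := H.isProbabilityMeasure_directionLaw
  exact (H.continuous_regret τ x).integrable_of_compactSpace

lemma integral_regret_le_of_forall (H : WrapperAssumptions K z₁ η r δ f D G M)
    {x : Eucl k} {c : ℝ}
    (h : ∀ u, wrapperRegret (pftrl K z₁ η) r δ τ f u x ≤ c) :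
    ∫ u, wrapperRegret (pftrl K z₁ η) r δ τ f u x ∂(directionLaw k T) ≤ c := by
  have := H.isProbabilityMeasure_directionLaw
  calc _ ≤ ∫ _, c ∂(directionLaw k T) :=
        integral_mono (H.integrable_regret τ x) (integrable_const c) h
    _ = c := by simp

lemma regret_le_lipschitz (H : WrapperAssumptions K z₁ η r δ f D G M)
    (u : Fin T → USphere k) {x : Eucl k} (hx : x ∈ K) :
    wrapperRegret (pftrl K z₁ η) r δ τ f u x ≤ T * (G * D) := by
  have hG := H.G_pos
  calc _ ≤ ∑ _t : Fin T, G * D := by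
        refine Finset.sum_le_sum fun t _ => ?_
        have h1 := H.loss_lipschitz t _ (H.pred_mem τ u t) _ hx
        have h2 := H.diam_le _ (H.pred_mem τ u t) _ hx
        exact (le_abs_self _).trans (h1.trans (by gcongr))
    _ = T * (G * D) := by simp

lemma regret_le_bounded (H : WrapperAssumptions K z₁ η r δ f D G M)
    (u : Fin T → USphere k) {x : Eucl k} (hx : x ∈ K) :
    wrapperRegret (pftrl K z₁ η) r δ τ f u x ≤ T * (2 * M) := by
  calc _ ≤ ∑ _t : Fin T, 2 * M := by
        refine Finset.sum_le_sum fun t _ => ?_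
        have h1 := (abs_le.1 (H.loss_bounded t _ (H.pred_mem τ u t))).2
        have h2 := (abs_le.1 (H.loss_bounded t _ hx)).1
        linarith
    _ = T * (2 * M) := by simp

lemma sum_stepWeight_range_pos (H : WrapperAssumptions K z₁ η r δ f D G M)
    (n : ℕ) : 0 < ∑ m ∈ Finset.range (n + 1), stepWeight η m := by
  rw [sum_stepWeight]
  exact one_div_pos.2 (H.rate_pos n)

/-- The regret of P-FTRL on the observed loss vectors. -/
lemma linear_regret_le (H : WrapperAssumptions K z₁ η r δ f D G M)
    (hT : 1 ≤ T) (u : Fin T → USphere k) {x : Eucl k} (hx : x ∈ K) :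
    ∑ t, inner ℝ (wrapperLoss (pftrl K z₁ η) r δ τ f u t)
        (wrapperIterate K z₁ η r δ τ f u (τ.obsPos t) - x)
      ≤ D ^ 2 / (2 * η T) + ∑ m : Fin T, η ((m : ℕ) + 1)
          * (k * M / δ ((τ.obsOrder m : ℕ) + 1)) ^ 2 / 2 := by
  set z := wrapperIterate K z₁ η r δ τ f u with hz
  set c := observedLoss (pftrl K z₁ η) r δ τ f u with hc
  have hcm : ∀ m : Fin T, c m = wrapperLoss (pftrl K z₁ η) r δ τ f u (τ.obsOrder m) := fun m => by
    rw [hc, observedLoss, dif_pos m.2]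
  -- Along the observation order each loss meets the iterate immediately preceding it, so this is
  -- regret without delay.
  have h1 : ∑ t, inner ℝ (wrapperLoss (pftrl K z₁ η) r δ τ f u t) (z (τ.obsPos t) - x)
      = ∑ n ∈ Finset.range T, inner ℝ (c n) (z n - x) := by
    rw [← Fin.sum_univ_eq_sum_range (fun n => inner ℝ (c n) (z n - x)) T,
      ← Equiv.sum_comp τ.obsOrder]
    refine Finset.sum_congr rfl fun m _ => ?_
    rw [τ.obsPos_obsOrder, hcm]
  rw [h1]
  refine (IsProximalFTRL.regret_le (H.isProximalFTRL τ u) T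
    (fun n _ => H.sum_stepWeight_range_pos n) hx).trans (add_le_add ?_ ?_)
  · calc _ ≤ ∑ n ∈ Finset.range T, stepWeight η n * (D ^ 2 / 2) := by
          refine Finset.sum_le_sum fun n _ => ?_
          rw [mul_div_assoc]
          have := H.weight_nonneg n
          have hd := H.diam_le _ (H.iterate_mem τ u n) _ hx
          gcongr
      _ = D ^ 2 / (2 * η T) := by
          obtain ⟨N, rfl⟩ : ∃ N, T = N + 1 := ⟨T - 1, by lia⟩
          rw [← Finset.sum_mul, sum_stepWeight]
          have := (H.rate_pos N).ne'
          field_simp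
  · rw [← Fin.sum_univ_eq_sum_range (fun n => ‖c n‖ ^ 2 /
      (2 * ∑ m ∈ Finset.range (n + 1), stepWeight η m)) T]
    refine Finset.sum_le_sum fun m _ => ?_
    rw [sum_stepWeight, hcm]
    have h2 := H.norm_loss_le τ u (τ.obsOrder m)
    have h3 := H.rate_pos m
    calc _ = η ((m : ℕ) + 1) * ‖wrapperLoss (pftrl K z₁ η) r δ τ f u (τ.obsOrder m)‖ ^ 2 / 2 := by
          field_simp
      _ ≤ _ := by gcongr

section Noise

/-- The centered loss vector of round `t` is orthogonal to every vector that does not depend on the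
direction `u_t`. -/
lemma integral_inner_noise (H : WrapperAssumptions K z₁ η r δ f D G M)
    (t : Fin T) {h : (Fin T → USphere k) → Eucl k} (hh : Continuous h)
    (hu : ∀ u v, h (Function.update u t v) = h u) :
    ∫ u, inner ℝ (h u) (wrapperLoss (pftrl K z₁ η) r δ τ f u t
      - wrapperMeanLoss K z₁ η r δ τ f u t) ∂(directionLaw k T) = 0 := by
  have := H.isProbabilityMeasure_directionLaw
  have h1 : Continuous fun u => inner ℝ (wrapperLoss (pftrl K z₁ η) r δ τ f u t) (h u) :=
    (H.continuous_loss τ t).inner hh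
  have h2 : Continuous fun u => inner ℝ (wrapperMeanLoss K z₁ η r δ τ f u t) (h u) :=
    (H.continuous_meanLoss τ t).inner hh
  simp_rw [real_inner_comm _ (h _), inner_sub_left]
  rw [integral_sub h1.integrable_of_compactSpace h2.integrable_of_compactSpace,
    H.integral_inner_loss τ t hh hu, sub_self]

/-- The errors behave like martingale differences in observation order: the earlier one uses an
iterate that does not yet depend on the direction of the later one, even if the prediction of the
later one was made first. -/
lemma integral_inner_noise_noise (H : WrapperAssumptions K z₁ η r δ f D G M)
    {i j : Fin T} (hij : i ≠ j) :
    ∫ u, inner ℝ (wrapperLoss (pftrl K z₁ η) r δ τ f u (τ.obsOrder i)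
        - wrapperMeanLoss K z₁ η r δ τ f u (τ.obsOrder i))
      (wrapperLoss (pftrl K z₁ η) r δ τ f u (τ.obsOrder j)
        - wrapperMeanLoss K z₁ η r δ τ f u (τ.obsOrder j)) ∂(directionLaw k T) = 0 := by
  wlog hlt : i < j generalizing i j
  · rw [← this hij.symm (lt_of_le_of_ne (not_lt.1 hlt) hij.symm)]
    simp_rw [real_inner_comm]
  refine H.integral_inner_noise τ _ ((H.continuous_loss τ _).sub (H.continuous_meanLoss τ _))
    fun u v => ?_
  have hseen : τ.seen (τ.obsOrder i) ≤ τ.obsPos (τ.obsOrder j) := by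
    have := τ.seen_le_obsPos (τ.obsOrder i)
    rw [τ.obsPos_obsOrder] at this ⊢
    exact this.trans (Fin.le_def.1 hlt.le)
  rw [wrapperLoss_pftrl, wrapperLoss_pftrl, wrapperMeanLoss, wrapperMeanLoss,
    wrapperIterate_update K z₁ η r δ τ f u _ v hseen,
    Function.update_of_ne (fun h => hij (τ.obsOrder.injective h))]

/-- The mean norm of a sum of loss vectors grows like the sum of the conditional means, up to a
constant. -/
lemma integral_norm_sum_loss_le (H : WrapperAssumptions K z₁ η r δ f D G M)
    {L : ℝ} (hL : ∀ t : Fin T, k * M / δ ((t : ℕ) + 1) ≤ L)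
    (hL0 : 0 < L) {n m : ℕ} (hnm : n ≤ m) (hm : m ≤ T) :
    ∫ u, ‖∑ j ∈ Finset.Ico n m, observedLoss (pftrl K z₁ η) r δ τ f u j‖ ∂(directionLaw k T)
      ≤ L ^ 2 / G + 2 * G * (m - n : ℝ) := by
  have := H.isProbabilityMeasure_directionLaw
  have hprob := isProbabilityMeasure_unifSphere H.one_le_k
  have hG := H.G_pos
  set J : Finset (Fin T) := Finset.univ.filter fun j => n ≤ j ∧ (j : ℕ) < m with hJ
  have hsum : ∀ F : ℕ → Eucl k, ∑ j ∈ Finset.Ico n m, F j = ∑ j ∈ J, F j := by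
    intro F
    have h2 : Finset.Ico n m = (Finset.range T).filter fun j => n ≤ j ∧ j < m := by
      ext j
      simp only [Finset.mem_Ico, Finset.mem_filter, Finset.mem_range]
      lia
    rw [h2, Finset.sum_filter, ← Fin.sum_univ_eq_sum_range
      (fun j => if n ≤ j ∧ j < m then F j else 0) T, hJ, Finset.sum_filter]
  have hcard : (J.card : ℝ) = m - n := by
    have h2 : J.card = (Finset.Ico n m).card := by
      rw [← Finset.card_map Fin.valEmbedding]
      congr 1
      ext j
      simp only [hJ, Finset.mem_map, Finset.mem_filter, Finset.mem_univ, true_and,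
        Fin.valEmbedding_apply, Finset.mem_Ico]
      constructor
      · rintro ⟨a, ha, rfl⟩
        exact ha
      · intro h
        exact ⟨⟨j, by lia⟩, h, rfl⟩
    rw [h2, Nat.card_Ico, Nat.cast_sub hnm]
  set c : Fin T → (Fin T → USphere k) → Eucl k :=
    fun j u => wrapperLoss (pftrl K z₁ η) r δ τ f u (τ.obsOrder j) with hc
  set g : Fin T → (Fin T → USphere k) → Eucl k :=
    fun j u => wrapperMeanLoss K z₁ η r δ τ f u (τ.obsOrder j) with hg
  have hobs : ∀ u, ∑ j ∈ Finset.Ico n m, observedLoss (pftrl K z₁ η) r δ τ f u j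
      = ∑ j ∈ J, g j u + ∑ j ∈ J, (c j u - g j u) := by
    intro u
    rw [hsum, ← Finset.sum_add_distrib]
    refine Finset.sum_congr rfl fun j _ => ?_
    rw [observedLoss, dif_pos j.2, add_sub_cancel]
  have hcc : ∀ j, Continuous (c j) := fun j => H.continuous_loss τ _
  have hgc : ∀ j, Continuous (g j) := fun j => H.continuous_meanLoss τ _
  have hcL : ∀ j u, ‖c j u‖ ≤ L := fun j u => (H.norm_loss_le τ u _).trans (hL _)
  -- Averaging the estimates gives the bound `L` for the means directly, so no comparison of `G`
  -- with `L` is required.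
  have hgL : ∀ j u, ‖g j u‖ ≤ L := by
    intro j u
    have h3 : ∀ v : USphere k, ‖gradEst (f (τ.obsOrder j)) (δ ((τ.obsOrder j : ℕ) + 1))
        ((1 - δ ((τ.obsOrder j : ℕ) + 1) / r)
          • wrapperIterate K z₁ η r δ τ f u (τ.seen (τ.obsOrder j))) v‖ ≤ L := fun v =>
      (norm_gradEst_le (H.delta_pos _) (H.loss_bounded _)
        (H.shrink_add_mem _ (H.iterate_mem τ u _) v)).trans (hL _)
    have h4 := norm_integral_le_of_norm_le_const (μ := unifSphere k)
      (Filter.Eventually.of_forall h3)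
    simpa [hg, wrapperMeanLoss, meanGrad] using h4
  have hsq : ∫ u, ‖∑ j ∈ J, (c j u - g j u)‖ ^ 2 ∂(directionLaw k T) ≤ J.card * (4 * L ^ 2) := by
    have h5 : ∀ i j, Integrable (fun u => inner ℝ (c i u - g i u) (c j u - g j u))
        (directionLaw k T) := fun i j =>
      Continuous.integrable_of_compactSpace
        (((hcc i).sub (hgc i)).inner ((hcc j).sub (hgc j)))
    simp_rw [← real_inner_self_eq_norm_sq, sum_inner, inner_sum]
    rw [integral_finsetSum _ fun i _ => integrable_finsetSum _ fun j _ => h5 i j]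
    simp_rw [integral_finsetSum _ fun j _ => h5 _ j]
    have h6 : ∀ i ∈ J, ∑ j ∈ J, ∫ u, inner ℝ (c i u - g i u) (c j u - g j u) ∂(directionLaw k T)
        ≤ 4 * L ^ 2 := by
      intro i hi
      rw [Finset.sum_eq_single_of_mem i hi
        fun j _ hj => H.integral_inner_noise_noise τ hj.symm]
      calc _ ≤ ∫ _, 4 * L ^ 2 ∂(directionLaw k T) := by
            refine integral_mono (h5 i i) (integrable_const _) fun u => ?_
            simp only [real_inner_self_eq_norm_sq]
            have h7 : ‖c i u - g i u‖ ≤ 2 * L :=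
              (norm_sub_le _ _).trans (by linarith [hcL i u, hgL i u])
            nlinarith [norm_nonneg (c i u - g i u)]
        _ = 4 * L ^ 2 := by simp
    calc _ ≤ ∑ _i ∈ J, 4 * L ^ 2 := Finset.sum_le_sum h6
      _ = _ := by simp
  have hξc : Continuous fun u => ∑ j ∈ J, (c j u - g j u) :=
    continuous_finsetSum _ fun j _ => (hcc j).sub (hgc j)
  have hi2 : Integrable (fun u => ‖∑ j ∈ J, (c j u - g j u)‖ ^ 2) (directionLaw k T) :=
    (hξc.norm.pow 2).integrable_of_compactSpace
  have hpt : ∀ u, ‖∑ j ∈ Finset.Ico n m, observedLoss (pftrl K z₁ η) r δ τ f u j‖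
      ≤ (J.card * G + L ^ 2 / G) + G / (4 * L ^ 2) * ‖∑ j ∈ J, (c j u - g j u)‖ ^ 2 := by
    intro u
    rw [hobs]
    refine (norm_add_le _ _).trans ?_
    have h8 : ‖∑ j ∈ J, g j u‖ ≤ J.card * G := by
      refine (norm_sum_le _ _).trans ((Finset.sum_le_sum
        fun j _ => H.norm_meanLoss_le τ u (τ.obsOrder j)).trans ?_)
      simp
    set X := ‖∑ j ∈ J, (c j u - g j u)‖
    -- The weight in this instance of Young's inequality is chosen so that the second moment `4 * L
    -- ^ 2 * J.card` contributes exactly `G * J.card`, the size of the mean part.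
    have h9 : X ≤ L ^ 2 / G + G / (4 * L ^ 2) * X ^ 2 := by
      have : L ^ 2 / G + G / (4 * L ^ 2) * X ^ 2 - X
          = (2 * L ^ 2 - G * X) ^ 2 / (4 * L ^ 2 * G) := by
        field_simp
        ring
      have : 0 ≤ (2 * L ^ 2 - G * X) ^ 2 / (4 * L ^ 2 * G) := by positivity
      linarith
    linarith
  have hcont : Continuous fun u =>
      ‖∑ j ∈ Finset.Ico n m, observedLoss (pftrl K z₁ η) r δ τ f u j‖ := by
    simp_rw [hobs]
    exact ((continuous_finsetSum _ fun j _ => hgc j).add hξc).norm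
  calc _ ≤ ∫ u, ((J.card * G + L ^ 2 / G) + G / (4 * L ^ 2) * ‖∑ j ∈ J, (c j u - g j u)‖ ^ 2)
          ∂(directionLaw k T) :=
        integral_mono hcont.integrable_of_compactSpace
          ((integrable_const _).add (hi2.const_mul _)) hpt
    _ = (J.card * G + L ^ 2 / G)
          + G / (4 * L ^ 2) * ∫ u, ‖∑ j ∈ J, (c j u - g j u)‖ ^ 2 ∂(directionLaw k T) := by
        rw [integral_add (integrable_const _) (hi2.const_mul _), integral_const_mul]
        simp
    _ ≤ (J.card * G + L ^ 2 / G) + G / (4 * L ^ 2) * (J.card * (4 * L ^ 2)) := by gcongr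
    _ = _ := by
        rw [hcard]
        field_simp
        ring

end Noise

/-- The mean drift of the iterates. -/
lemma integral_drift_le (H : WrapperAssumptions K z₁ η r δ f D G M)
    {L : ℝ} (hL : ∀ t : Fin T, k * M / δ ((t : ℕ) + 1) ≤ L)
    (hL0 : 0 < L) {n m : ℕ} (hnm : n ≤ m) (hm : m ≤ T) :
    ∫ u, ‖wrapperIterate K z₁ η r δ τ f u m - wrapperIterate K z₁ η r δ τ f u n‖
        ∂(directionLaw k T)
      ≤ L ^ 2 / G * η (n + 1) + ∑ j ∈ Finset.Ico n m, 2 * G * η (j + 1) := by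
  have := H.isProbabilityMeasure_directionLaw
  have hG := H.G_pos
  set z := fun u => wrapperIterate K z₁ η r δ τ f u with hz
  set W : ℕ → ℝ := fun m => ∫ u, ‖z u m - z u n‖ ∂(directionLaw k T) with hW
  have hzc : ∀ j, Continuous fun u => ‖z u j - z u n‖ := fun j =>
    ((H.continuous_iterate τ j).sub (H.continuous_iterate τ n)).norm
  have hzi : ∀ j, Integrable (fun u => ‖z u j - z u n‖) (directionLaw k T) := fun j =>
    (hzc j).integrable_of_compactSpace
  have hoc : ∀ j, Continuous fun u => observedLoss (pftrl K z₁ η) r δ τ f u j := by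
    intro j
    simp only [observedLoss]
    split_ifs
    · exact H.continuous_loss τ _
    · exact continuous_const
  have hrec : ∀ m, n < m → m ≤ T → (∑ j ∈ Finset.range m, stepWeight η j) * W m
      ≤ L ^ 2 / G + 2 * G * (m - n : ℝ) + ∑ j ∈ Finset.Ico n m, stepWeight η j * W j := by
    intro m hnm hm
    have hci : Integrable (fun u => ‖∑ j ∈ Finset.Ico n m,
        observedLoss (pftrl K z₁ η) r δ τ f u j‖) (directionLaw k T) :=
      Continuous.integrable_of_compactSpace
        (continuous_finsetSum _ fun j _ => hoc j).norm
    have hsi : Integrable (fun u => ∑ j ∈ Finset.Ico n m, stepWeight η j * ‖z u j - z u n‖)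
        (directionLaw k T) := integrable_finsetSum _ fun j _ => (hzi j).const_mul _
    calc _ = ∫ u, (∑ j ∈ Finset.range m, stepWeight η j) * ‖z u m - z u n‖ ∂(directionLaw k T) := by
          rw [integral_const_mul]
      _ ≤ ∫ u, (‖∑ j ∈ Finset.Ico n m, observedLoss (pftrl K z₁ η) r δ τ f u j‖
            + ∑ j ∈ Finset.Ico n m, stepWeight η j * ‖z u j - z u n‖) ∂(directionLaw k T) :=
          integral_mono ((hzi m).const_mul _) (hci.add hsi) fun u =>
            IsProximalFTRL.mul_norm_sub_le (H.isProximalFTRL τ u) H.weight_nonneg hnm.le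
      _ = ∫ u, ‖∑ j ∈ Finset.Ico n m, observedLoss (pftrl K z₁ η) r δ τ f u j‖ ∂(directionLaw k T)
            + ∑ j ∈ Finset.Ico n m, stepWeight η j * W j := by
          rw [integral_add hci hsi, integral_finsetSum _ fun j _ => (hzi j).const_mul _]
          simp_rw [integral_const_mul, hW]
      _ ≤ _ := by
          gcongr
          exact H.integral_norm_sum_loss_le τ hL hL0 hnm.le hm
  have h := drift_recursion_le (β := stepWeight η) (W := W) H.weight_nonneg (n := n)
    (a := L ^ 2 / G) (b := 2 * G) (by positivity) (by positivity)
    (fun j _ => H.sum_stepWeight_range_pos j) (by simp [hW]) hrec hnm hm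
  refine h.trans (le_of_eq ?_)
  simp_rw [sum_stepWeight, div_div_eq_mul_div, div_one]

/-- The regret bound of the wrapper with P-FTRL in terms of its parameters. -/
lemma integral_regret_le (H : WrapperAssumptions K z₁ η r δ f D G M)
    (hT : 1 ≤ T) {L : ℝ} (hL : ∀ t : Fin T, k * M / δ ((t : ℕ) + 1) ≤ L)
    (hL0 : 0 < L) {x : Eucl k} (hx : x ∈ K) :
    ∫ u, wrapperRegret (pftrl K z₁ η) r δ τ f u x ∂(directionLaw k T)
      ≤ ∑ t : Fin T, 7 * (G * D) * (δ ((t : ℕ) + 1) / r)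
        + (D ^ 2 / (2 * η T) + ∑ m : Fin T, η ((m : ℕ) + 1)
          * (k * M / δ ((τ.obsOrder m : ℕ) + 1)) ^ 2 / 2)
        + ∑ t : Fin T, G * min D (L ^ 2 / G * η (τ.seen t + 1)
            + ∑ j ∈ Finset.Ico (τ.seen t) (τ.obsPos t), 2 * G * η (j + 1)) := by
  have := H.isProbabilityMeasure_directionLaw
  have hG := H.G_pos
  set z := fun u => wrapperIterate K z₁ η r δ τ f u with hz
  set c := fun u t => wrapperLoss (pftrl K z₁ η) r δ τ f u t with hc
  set g := fun u t => wrapperMeanLoss K z₁ η r δ τ f u t with hg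
  set e : Fin T → ℝ := fun t => 7 * (G * D) * (δ ((t : ℕ) + 1) / r) with he
  have hzc : ∀ j, Continuous fun u => z u j := H.continuous_iterate τ
  have hdrift : ∀ t, Integrable (fun u => ‖z u (τ.obsPos t) - z u (τ.seen t)‖)
      (directionLaw k T) := fun t => ((hzc _).sub (hzc _)).norm.integrable_of_compactSpace
  have hgi : ∀ t, Integrable (fun u => inner ℝ (g u t) (z u (τ.obsPos t) - x))
      (directionLaw k T) := fun t => Continuous.integrable_of_compactSpace
    ((H.continuous_meanLoss τ t).inner ((hzc _).sub continuous_const))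
  have hci : ∀ t, Integrable (fun u => inner ℝ (c u t) (z u (τ.obsPos t) - x))
      (directionLaw k T) := fun t => Continuous.integrable_of_compactSpace
    ((H.continuous_loss τ t).inner ((hzc _).sub continuous_const))
  have hpt : ∀ u, wrapperRegret (pftrl K z₁ η) r δ τ f u x
      ≤ ∑ t, (e t + inner ℝ (g u t) (z u (τ.obsPos t) - x)
        + G * ‖z u (τ.obsPos t) - z u (τ.seen t)‖) := by
    intro u
    refine Finset.sum_le_sum fun t _ => ?_
    have h1 := H.round_regret_le τ u t hx
    have h2 : inner ℝ (g u t) (z u (τ.seen t) - x) = inner ℝ (g u t) (z u (τ.obsPos t) - x)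
        + inner ℝ (g u t) (z u (τ.seen t) - z u (τ.obsPos t)) := by
      rw [← inner_add_right]
      congr 1
      abel
    have h3 : inner ℝ (g u t) (z u (τ.seen t) - z u (τ.obsPos t))
        ≤ G * ‖z u (τ.obsPos t) - z u (τ.seen t)‖ := by
      refine (real_inner_le_norm _ _).trans ?_
      rw [norm_sub_rev]
      gcongr
      exact H.norm_meanLoss_le τ u t
    simp only [hz, hg, he] at h2 h3 ⊢
    linarith
  -- The iterate at `obsPos t` has processed only feedback received before that of `t`, so it does
  -- not depend on `u t`.
  have hswap : ∀ t, ∫ u, inner ℝ (g u t) (z u (τ.obsPos t) - x) ∂(directionLaw k T)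
      = ∫ u, inner ℝ (c u t) (z u (τ.obsPos t) - x) ∂(directionLaw k T) := fun t =>
    (H.integral_inner_loss τ t (h := fun u => z u (τ.obsPos t) - x)
      ((hzc _).sub continuous_const) fun u v => by
      simp only [hz, wrapperIterate_update K z₁ η r δ τ f u t v le_rfl]).symm
  have hlin : ∑ t, ∫ u, inner ℝ (g u t) (z u (τ.obsPos t) - x) ∂(directionLaw k T)
      ≤ D ^ 2 / (2 * η T) + ∑ m : Fin T, η ((m : ℕ) + 1)
          * (k * M / δ ((τ.obsOrder m : ℕ) + 1)) ^ 2 / 2 := by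
    simp_rw [hswap]
    rw [← integral_finsetSum _ fun t _ => hci t]
    calc _ ≤ ∫ _, (D ^ 2 / (2 * η T) + ∑ m : Fin T, η ((m : ℕ) + 1)
          * (k * M / δ ((τ.obsOrder m : ℕ) + 1)) ^ 2 / 2) ∂(directionLaw k T) :=
          integral_mono (integrable_finsetSum _ fun t _ => hci t) (integrable_const _)
            fun u => H.linear_regret_le τ hT u hx
      _ = _ := by simp
  have hdr : ∀ t, ∫ u, ‖z u (τ.obsPos t) - z u (τ.seen t)‖ ∂(directionLaw k T)
      ≤ min D (L ^ 2 / G * η (τ.seen t + 1)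
            + ∑ j ∈ Finset.Ico (τ.seen t) (τ.obsPos t), 2 * G * η (j + 1)) := by
    intro t
    refine le_min ?_ (H.integral_drift_le τ hL hL0 (τ.seen_le_obsPos t) (τ.obsPos t).2.le)
    calc _ ≤ ∫ _, D ∂(directionLaw k T) :=
          integral_mono (hdrift t) (integrable_const _) fun u =>
            H.diam_le _ (H.iterate_mem τ u _) _ (H.iterate_mem τ u _)
      _ = D := by simp
  have hi : ∀ t, Integrable (fun u => e t + inner ℝ (g u t) (z u (τ.obsPos t) - x)
        + G * ‖z u (τ.obsPos t) - z u (τ.seen t)‖) (directionLaw k T) := fun t =>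
    ((integrable_const _).add (hgi t)).add ((hdrift t).const_mul _)
  calc _ ≤ ∫ u, ∑ t, (e t + inner ℝ (g u t) (z u (τ.obsPos t) - x)
        + G * ‖z u (τ.obsPos t) - z u (τ.seen t)‖) ∂(directionLaw k T) :=
        integral_mono (H.integrable_regret τ x) (integrable_finsetSum _ fun t _ => hi t) hpt
    _ = ∑ t, (e t + ∫ u, inner ℝ (g u t) (z u (τ.obsPos t) - x) ∂(directionLaw k T)
        + G * ∫ u, ‖z u (τ.obsPos t) - z u (τ.seen t)‖ ∂(directionLaw k T)) := by
        rw [integral_finsetSum _ fun t _ => hi t]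
        refine Finset.sum_congr rfl fun t _ => ?_
        have hi1 : Integrable (fun u => e t + inner ℝ (g u t) (z u (τ.obsPos t) - x))
            (directionLaw k T) := (integrable_const _).add (hgi t)
        rw [integral_add hi1 ((hdrift t).const_mul _),
          integral_add (integrable_const _) (hgi t), integral_const_mul G]
        simp
    _ ≤ _ := by
        rw [Finset.sum_add_distrib, Finset.sum_add_distrib]
        gcongr with t
        exact hdr t

end WrapperAssumptions

/-! ### Elementary sums -/

/-- Bernoulli's inequality for `(1 - 1 / (n + 1)) ^ (1 - p)` makes the increment of `n ^ (1 - p) /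
(1 - p)` dominate the next term. -/
lemma sum_rpow_neg_le {p : ℝ} (hp0 : 0 ≤ p) (hp1 : p < 1) (T : ℕ) :
    ∑ t : Fin T, (((t : ℕ) : ℝ) + 1) ^ (-p) ≤ (T : ℝ) ^ (1 - p) / (1 - p) := by
  rw [Fin.sum_univ_eq_sum_range (fun t => ((t : ℝ) + 1) ^ (-p)) T]
  have hq : 0 < 1 - p := by linarith
  induction T with
  | zero => simp [Real.zero_rpow hq.ne']
  | succ n ih =>
    rw [Finset.sum_range_succ]
    have hn : (0 : ℝ) < (n : ℝ) + 1 := by positivity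
    have hb := rpow_one_add_le_one_add_mul_self (s := -(1 / ((n : ℝ) + 1))) (p := 1 - p)
      (by rw [neg_le_neg_iff, div_le_one hn]; linarith [Nat.cast_nonneg (α := ℝ) n])
      hq.le (by linarith)
    have h1 : 1 + -(1 / ((n : ℝ) + 1)) = n / (n + 1) := by field_simp; ring
    rw [h1, Real.div_rpow (by positivity) hn.le] at hb
    have hpos : 0 < ((n : ℝ) + 1) ^ (1 - p) := Real.rpow_pos_of_pos hn _
    rw [div_le_iff₀ hpos] at hb
    have h2 : ((n : ℝ) + 1) ^ (-p) = ((n : ℝ) + 1) ^ (1 - p) / (n + 1) := by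
      rw [show -p = (1 - p) - 1 by ring, Real.rpow_sub_one hn.ne']
    have h3 : (n : ℝ) ^ (1 - p) ≤ ((n : ℝ) + 1) ^ (1 - p)
        - (1 - p) * ((n : ℝ) + 1) ^ (-p) := by
      rw [h2]
      calc _ ≤ _ := hb
        _ = _ := by ring
    push_cast
    rw [le_div_iff₀ hq] at ih ⊢
    linarith

lemma div_sqrt_le_two_mul_sub {S x y : ℝ} (hS : 0 ≤ S) (hx : 0 ≤ x) (hy : S + x ≤ y) :
    x / √y ≤ 2 * (√(S + x) - √S) := by
  rcases hx.eq_or_lt with rfl | hx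
  · simp
  have h1 : 0 < √(S + x) := Real.sqrt_pos.2 (by linarith)
  have h2 : √(S + x) ≤ √y := Real.sqrt_le_sqrt hy
  have h3 : √S ≤ √(S + x) := Real.sqrt_le_sqrt (by linarith)
  have h4 := Real.sq_sqrt hS
  have h5 := Real.sq_sqrt (by linarith : 0 ≤ S + x)
  rw [div_le_iff₀ (by linarith)]
  nlinarith [Real.sqrt_nonneg S]

/-- Each term is at most twice the increment of the square root of the partial sums, so the bound
telescopes. It is applied to the dual backlogs and to the squared loss scales, both of which occur
in the learning rate denominators. -/
lemma sum_div_sqrt_le {T : ℕ} {x y : Fin T → ℝ} (hx : ∀ m, 0 ≤ x m)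
    (hy : ∀ m, ∑ j, (if j ≤ m then x j else 0) ≤ y m) :
    ∑ m, x m / √(y m) ≤ 2 * √(∑ m, x m) := by
  induction T with
  | zero => simp
  | succ n ih =>
    rw [Fin.sum_univ_castSucc, Fin.sum_univ_castSucc (f := x)]
    have h1 := ih (x := fun m => x m.castSucc) (y := fun m => y m.castSucc) (fun m => hx _)
      (fun m => by
        have := hy m.castSucc
        rw [Fin.sum_univ_castSucc] at this
        simpa [Fin.not_le.2 (Fin.castSucc_lt_last m)] using this)
    have h2 := hy (Fin.last n)
    rw [Fin.sum_univ_castSucc] at h2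
    simp only [Fin.le_last, if_true] at h2
    have h3 := div_sqrt_le_two_mul_sub (Finset.sum_nonneg fun m _ => hx (Fin.castSucc m))
      (hx (Fin.last n)) h2
    linarith

lemma sum_sqrt_ge (n : ℕ) : (n : ℝ) * √n / 2 ≤ ∑ m ∈ Finset.range n, √((m : ℝ) + 1) := by
  rcases n.eq_zero_or_pos with rfl | hn
  · simp
  have hn' : 0 < √(n : ℝ) := Real.sqrt_pos.2 (by exact_mod_cast hn)
  have hsq := Real.mul_self_sqrt (Nat.cast_nonneg (α := ℝ) n)
  have h1 : ∀ m ∈ Finset.range n, ((m : ℝ) + 1) / √n ≤ √((m : ℝ) + 1) := by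
    intro m hm
    have hm' : (m : ℝ) + 1 ≤ n := by exact_mod_cast Finset.mem_range.1 hm
    rw [div_le_iff₀ hn']
    have h2 : √((m : ℝ) + 1) ≤ √n := Real.sqrt_le_sqrt hm'
    have h3 := Real.mul_self_sqrt (by positivity : (0 : ℝ) ≤ (m : ℝ) + 1)
    nlinarith [Real.sqrt_nonneg ((m : ℝ) + 1)]
  refine le_trans ?_ (Finset.sum_le_sum h1)
  rw [← Finset.sum_div]
  have h4 : ∀ n : ℕ, ∑ m ∈ Finset.range n, ((m : ℝ) + 1) = n * (n + 1) / 2 := by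
    intro n
    induction n with
    | zero => simp
    | succ n ih => rw [Finset.sum_range_succ, ih]; push_cast; ring
  rw [h4, le_div_iff₀ hn']
  nlinarith

/-- A set of `n` distinct positive integers has sum at least `1 + ... + n`. -/
lemma card_mul_card_add_one_le {T : ℕ} (U : Finset (Fin T)) :
    U.card * (U.card + 1) ≤ 2 * ∑ t ∈ U, ((t : ℕ) + 1) := by
  induction U using Finset.induction_on_max with
  | empty => simp
  | insert a U ha ih =>
    have hU : a ∉ U := fun h => lt_irrefl a (ha a h)
    have hcard : U.card ≤ a := by
      have h : U ⊆ Finset.Iio a := fun t ht => Finset.mem_Iio.2 (ha t ht)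
      simpa using Finset.card_le_card h
    rw [Finset.card_insert_of_notMem hU, Finset.sum_insert hU]
    nlinarith

/-- Only few rounds see less than half of the feedback. -/
lemma Timeline.card_filter_two_mul_seen_lt_le {T : ℕ} (τ : Timeline T) :
    ((Finset.univ.filter fun t : Fin T => 2 * τ.seen t < t).card : ℝ)
      ≤ 2 * √(τ.totalDelay : ℝ) := by
  set U := Finset.univ.filter fun t : Fin T => 2 * τ.seen t < t with hU
  -- A round in `U` has at least `(t + 1) / 2` outstanding predecessors, and the numbers of
  -- outstanding predecessors sum to the total delay. Distinctness of the rounds then bounds the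
  -- square of the cardinality.
  have h1 : ∑ t ∈ U, ((t : ℕ) + 1) ≤ 2 * τ.totalDelay := by
    have h2 : ∑ t : Fin T, ((t : ℕ) - τ.seen t) = τ.totalDelay := by
      rw [Finset.sum_tsub_distrib _ fun t _ => τ.seen_le t, ← τ.sum_seen_add_totalDelay]
      lia
    rw [← h2, Finset.mul_sum]
    calc _ ≤ ∑ t ∈ U, 2 * ((t : ℕ) - τ.seen t) := by
          refine Finset.sum_le_sum fun t ht => ?_
          have := (Finset.mem_filter.1 ht).2
          lia
      _ ≤ _ := Finset.sum_le_sum_of_subset (Finset.subset_univ _)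
  have h5 : U.card * U.card ≤ 4 * τ.totalDelay := by
    have h6 := card_mul_card_add_one_le U
    nlinarith
  have h8 : (U.card : ℝ) ^ 2 ≤ 4 * τ.totalDelay := by
    rw [sq]
    exact_mod_cast h5
  calc (U.card : ℝ) ≤ √(4 * τ.totalDelay) := Real.le_sqrt_of_sq_le h8
    _ = 2 * √(τ.totalDelay : ℝ) := by
        rw [Real.sqrt_mul (by norm_num), show (4 : ℝ) = 2 ^ 2 by norm_num,
          Real.sqrt_sq (by norm_num)]

/-! ### Learning rates and smoothing schedules -/

section Rates

variable {T : ℕ} (k : ℕ) (D G r ν : ℝ) (δ : ℕ → ℝ) (τ : Timeline T)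

/-- The normalized loss scale of the `m`-th observation. -/
noncomputable def lossScale (m : Fin T) : ℝ :=
  ν * k * r / δ ((τ.obsOrder m : ℕ) + 1 + τ.delay (τ.obsOrder m))

/-- The quantity under the square root of the learning rate. -/
noncomputable def rateSum (n : ℕ) : ℝ :=
  (n : ℝ) + ∑ m ∈ Finset.univ.filter (fun m : Fin T => (m : ℕ) + 1 ≤ n),
    ((τ.dualBacklog (τ.obsOrder m) : ℝ) + lossScale k r ν δ τ m ^ 2)

lemma learningRate_eq (n : ℕ) :
    learningRate k D G r ν δ τ n = (D / G) / √(rateSum k r ν δ τ n) := rfl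

lemma rateSum_mono : Monotone (rateSum k r ν δ τ) := by
  intro m n hmn
  unfold rateSum
  have h1 : (m : ℝ) ≤ n := by exact_mod_cast hmn
  refine add_le_add h1 (Finset.sum_le_sum_of_subset_of_nonneg ?_ fun _ _ _ => by positivity)
  intro j hj
  simp only [Finset.mem_filter, Finset.mem_univ, true_and] at hj ⊢
  lia

/-- The summand `n` alone gives positivity. Index `0` is excluded: there the sum is zero and the
learning rate is zero by the convention for division. -/
lemma rateSum_succ_pos (n : ℕ) : 0 < rateSum k r ν δ τ (n + 1) := by
  unfold rateSum
  have : 0 ≤ ∑ m ∈ Finset.univ.filter (fun m : Fin T => (m : ℕ) + 1 ≤ n + 1),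
    ((τ.dualBacklog (τ.obsOrder m) : ℝ) + lossScale k r ν δ τ m ^ 2) :=
    Finset.sum_nonneg fun _ _ => by positivity
  positivity

lemma learningRate_succ_pos (hD : 0 < D) (hG : 0 < G) (n : ℕ) :
    0 < learningRate k D G r ν δ τ (n + 1) :=
  div_pos (div_pos hD hG) (Real.sqrt_pos.2 (rateSum_succ_pos k r ν δ τ n))

lemma stepWeight_learningRate_nonneg (hD : 0 < D) (hG : 0 < G) (n : ℕ) :
    0 ≤ stepWeight (learningRate k D G r ν δ τ) n := by
  have hpos := learningRate_succ_pos k D G r ν δ τ hD hG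
  cases n with
  | zero => exact (one_div_pos.2 (hpos 0)).le
  | succ n =>
    change 0 ≤ 1 / learningRate k D G r ν δ τ (n + 2) - 1 / learningRate k D G r ν δ τ (n + 1)
    refine sub_nonneg.2 (one_div_le_one_div_of_le (hpos (n + 1)) ?_)
    rw [learningRate_eq, learningRate_eq]
    have h1 := rateSum_succ_pos k r ν δ τ n
    have h2 := rateSum_mono k r ν δ τ (show n + 1 ≤ n + 2 by lia)
    gcongr

lemma sum_ite_dualBacklog_le (m : Fin T) :
    ∑ j : Fin T, (if j ≤ m then (τ.dualBacklog (τ.obsOrder j) : ℝ) else 0)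
      ≤ rateSum k r ν δ τ ((m : ℕ) + 1) := by
  rw [← Finset.sum_filter, rateSum]
  refine le_add_of_nonneg_of_le (Nat.cast_nonneg _) ?_
  simp only [add_le_add_iff_right, Fin.val_fin_le]
  exact Finset.sum_le_sum fun j _ => le_add_of_nonneg_right (sq_nonneg _)

lemma sum_ite_lossScale_le (m : Fin T) :
    ∑ j : Fin T, (if j ≤ m then lossScale k r ν δ τ j ^ 2 else 0)
      ≤ rateSum k r ν δ τ ((m : ℕ) + 1) := by
  rw [← Finset.sum_filter, rateSum]
  refine le_add_of_nonneg_of_le (Nat.cast_nonneg _) ?_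
  simp only [add_le_add_iff_right, Fin.val_fin_le]
  exact Finset.sum_le_sum fun j _ => le_add_of_nonneg_left (Nat.cast_nonneg _)

lemma rateSum_card : rateSum k r ν δ τ T
    = T + τ.totalDelay + ∑ m, lossScale k r ν δ τ m ^ 2 := by
  have h : (Finset.univ.filter fun m : Fin T => (m : ℕ) + 1 ≤ T) = Finset.univ := by
    ext m
    simp
  have h2 : ∑ m, (τ.dualBacklog (τ.obsOrder m) : ℝ) = τ.totalDelay := by
    rw [Equiv.sum_comp τ.obsOrder fun t => (τ.dualBacklog t : ℝ), ← τ.sum_dualBacklog]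
    push_cast
    rfl
  rw [rateSum, h, Finset.sum_add_distrib, h2, add_assoc]

/-- The properties of the smoothing schedules that the analysis uses. -/
structure IsSmoothingSchedule (T k : ℕ) (r ν : ℝ) (δ : ℕ → ℝ) : Prop where
  pos : ∀ t, 1 ≤ t → t ≤ T → 0 < δ t
  le : ∀ t, δ t ≤ r
  anti : ∀ s t, 1 ≤ s → s ≤ t → δ t ≤ δ s
  upper : ∀ t, 1 ≤ t → t ≤ T → δ t ≤ r * (√(ν * k) / (t : ℝ) ^ (1 / 4 : ℝ))
  lower : ν * k ≤ √T → ∀ t, 1 ≤ t → t ≤ T → r * (√(ν * k) / (T : ℝ) ^ (1 / 4 : ℝ)) ≤ δ t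

variable {k r ν δ}

lemma sqrt_div_rpow_le_one {N x : ℝ} (hx : 0 < x) (h : N ≤ √x) : √N / x ^ (1 / 4 : ℝ) ≤ 1 := by
  have hp : 0 < x ^ (1 / 4 : ℝ) := Real.rpow_pos_of_pos hx _
  rw [div_le_one hp]
  refine (Real.sqrt_le_sqrt h).trans (le_of_eq ?_)
  rw [Real.sqrt_eq_rpow, Real.sqrt_eq_rpow, ← Real.rpow_mul hx.le]
  norm_num

lemma isSmoothingSchedule_roundSchedule (hr : 0 < r) (hN : 0 < ν * k) :
    IsSmoothingSchedule T k r ν (roundSchedule k r ν) where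
  pos t h1 _ := by
    have : (0 : ℝ) < t := by exact_mod_cast h1
    unfold roundSchedule
    positivity
  le t := mul_le_of_le_one_right hr.le (min_le_left _ _)
  anti s t h1 h2 := by
    have : (0 : ℝ) < s := by exact_mod_cast h1
    have h3 : (s : ℝ) ≤ t := by exact_mod_cast h2
    unfold roundSchedule
    gcongr
  upper t _ _ := by
    unfold roundSchedule
    gcongr
    exact min_le_right _ _
  lower h t h1 h2 := by
    have h3 : (0 : ℝ) < t := by exact_mod_cast h1
    have h4 : (t : ℝ) ≤ T := by exact_mod_cast h2
    unfold roundSchedule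
    refine mul_le_mul_of_nonneg_left (le_min (sqrt_div_rpow_le_one (h3.trans_le h4) h) ?_) hr.le
    gcongr

lemma isSmoothingSchedule_fixedSchedule (hr : 0 < r) (hN : 0 < ν * k) :
    IsSmoothingSchedule T k r ν (fixedSchedule k T r ν) where
  pos t h1 h2 := by
    have : (0 : ℝ) < T := by exact_mod_cast h1.trans h2
    unfold fixedSchedule
    positivity
  le t := mul_le_of_le_one_right hr.le (min_le_left _ _)
  anti s t _ _ := le_rfl
  upper t h1 h2 := by
    have h3 : (0 : ℝ) < t := by exact_mod_cast h1
    have h4 : (t : ℝ) ≤ T := by exact_mod_cast h2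
    unfold fixedSchedule
    refine mul_le_mul_of_nonneg_left ((min_le_right _ _).trans ?_) hr.le
    gcongr
  lower h t h1 h2 := by
    have h3 : (0 : ℝ) < T := by exact_mod_cast h1.trans h2
    unfold fixedSchedule
    exact mul_le_mul_of_nonneg_left (le_min (sqrt_div_rpow_le_one h3 h) le_rfl) hr.le

end Rates

/-! ### Size of the loss scales and growth of the learning rate denominators. -/

section RateBounds

variable {T k : ℕ} {r ν : ℝ} {δ : ℕ → ℝ}

lemma sq_rpow_one_quarter {x : ℝ} (hx : 0 ≤ x) : (x ^ (1 / 4 : ℝ)) ^ 2 = √x := by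
  rw [Real.sqrt_eq_rpow, ← Real.rpow_natCast, ← Real.rpow_mul hx]
  norm_num

lemma sqrt_add_add_le {x y z : ℝ} (hx : 0 ≤ x) (hy : 0 ≤ y) (hz : 0 ≤ z) :
    √(x + y + z) ≤ √x + √y + √z := by
  refine Real.sqrt_le_iff.2 ⟨by positivity, ?_⟩
  have h : 0 ≤ √x * √y + √x * √z + √y * √z := by positivity
  nlinarith [Real.sq_sqrt hx, Real.sq_sqrt hy, Real.sq_sqrt hz]

lemma rpow_three_quarters {x : ℝ} (hx : 0 ≤ x) : x ^ (3 / 4 : ℝ) = √x * x ^ (1 / 4 : ℝ) := by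
  rw [Real.sqrt_eq_rpow, ← Real.rpow_add_of_nonneg hx (by norm_num) (by norm_num)]
  norm_num

lemma sq_mul_div_schedule {N x : ℝ} (hN : 0 < N) (hr : 0 < r) (hx : 0 < x) :
    (N * r / (r * (√N / x ^ (1 / 4 : ℝ)))) ^ 2 = N * √x := by
  have h1 : 0 < √N := Real.sqrt_pos.2 hN
  have h2 : 0 < x ^ (1 / 4 : ℝ) := Real.rpow_pos_of_pos hx _
  have h3 : N * r / (r * (√N / x ^ (1 / 4 : ℝ))) = √N * x ^ (1 / 4 : ℝ) := by
    field_simp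
    exact (Real.sq_sqrt hN.le).symm
  rw [h3, mul_pow, Real.sq_sqrt hN.le, sq_rpow_one_quarter hx.le]

namespace IsSmoothingSchedule

lemma lossScale_sq_le (hδ : IsSmoothingSchedule T k r ν δ) (hr : 0 < r) (hN : 0 < ν * k)
    (τ : Timeline T) (hNT : ν * k ≤ √T) (m : Fin T) :
    lossScale k r ν δ τ m ^ 2 ≤ ν * k * √T := by
  have hT : (0 : ℝ) < T := by exact_mod_cast m.pos
  have hlt := τ.add_delay_lt (τ.obsOrder m)
  have hq : 0 < (T : ℝ) ^ (1 / 4 : ℝ) := Real.rpow_pos_of_pos hT _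
  have hs : 0 < √(ν * k) := Real.sqrt_pos.2 hN
  have h1 := hδ.lower hNT ((τ.obsOrder m : ℕ) + 1 + τ.delay (τ.obsOrder m)) (by lia) (by lia)
  have h2 := hδ.pos ((τ.obsOrder m : ℕ) + 1 + τ.delay (τ.obsOrder m)) (by lia) (by lia)
  rw [← sq_mul_div_schedule hN hr hT, lossScale]
  gcongr

/-- The scale uses the smoothing radius of the arrival round. At least `m` other feedbacks precede
the `m`-th one (counted from zero), so this round has number at least `m + 1`; the round where the
prediction was made could be much earlier. -/
lemma le_lossScale_sq (hδ : IsSmoothingSchedule T k r ν δ) (hr : 0 < r) (hN : 0 < ν * k)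
    (τ : Timeline T) (m : Fin T) : ν * k * √((m : ℝ) + 1) ≤ lossScale k r ν δ τ m ^ 2 := by
  have hlt := τ.add_delay_lt (τ.obsOrder m)
  have hback := τ.dualBacklog_add_obsPos (τ.obsOrder m)
  rw [τ.obsPos_obsOrder] at hback
  set j := (τ.obsOrder m : ℕ) + 1 + τ.delay (τ.obsOrder m) with hj
  have hmj : (m : ℝ) + 1 ≤ j := by
    have : (m : ℕ) + 1 ≤ j := by lia
    exact_mod_cast this
  have hj0 : (0 : ℝ) < j := lt_of_lt_of_le (by positivity) hmj
  have h1 := hδ.upper j (by lia) (by lia)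
  have h2 := hδ.pos j (by lia) (by lia)
  calc ν * k * √((m : ℝ) + 1) ≤ ν * k * √(j : ℝ) := by gcongr
    _ ≤ _ := by
      rw [← sq_mul_div_schedule hN hr hj0, lossScale, ← hj]
      gcongr

lemma le_rateSum (hδ : IsSmoothingSchedule T k r ν δ) (hr : 0 < r) (hN : 0 < ν * k)
    (τ : Timeline T) {n : ℕ} (hn : n ≤ T) :
    ν * k * (n * √n / 2) ≤ rateSum k r ν δ τ n := by
  have h1 : ∑ m ∈ Finset.range n, ν * k * √((m : ℝ) + 1)
      = ∑ m ∈ Finset.univ.filter (fun m : Fin T => (m : ℕ) + 1 ≤ n),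
          ν * k * √(((m : ℕ) : ℝ) + 1) := by
    have h2 : Finset.range n = (Finset.range T).filter fun m => m + 1 ≤ n := by
      ext m
      simp only [Finset.mem_filter, Finset.mem_range]
      lia
    rw [h2, Finset.sum_filter, ← Fin.sum_univ_eq_sum_range
      (fun m => if m + 1 ≤ n then ν * k * √((m : ℝ) + 1) else 0) T, Finset.sum_filter]
  calc ν * k * (n * √n / 2) ≤ ν * k * ∑ m ∈ Finset.range n, √((m : ℝ) + 1) := by
        gcongr
        exact sum_sqrt_ge n
    _ = _ := by rw [Finset.mul_sum, h1]
    _ ≤ _ := by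
        rw [rateSum]
        refine le_add_of_nonneg_of_le (Nat.cast_nonneg _) (Finset.sum_le_sum fun m _ => ?_)
        exact le_add_of_nonneg_of_le (Nat.cast_nonneg _) (hδ.le_lossScale_sq hr hN τ m)

/-- In a round that has seen half of the feedback, the noise contributes little drift. -/
lemma sqrt_mul_rpow_le (hδ : IsSmoothingSchedule T k r ν δ) (hr : 0 < r) (hN : 0 < ν * k)
    (τ : Timeline T) {t : Fin T} (ht : (t : ℕ) ≤ 2 * τ.seen t) :
    √(ν * k) * ((t : ℝ) + 1) ^ (3 / 4 : ℝ) ≤ 3 * √(rateSum k r ν δ τ (τ.seen t + 1)) := by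
  have hseen := τ.seen_le t
  have htT := t.2
  have h1 := hδ.le_rateSum hr hN τ (n := τ.seen t + 1) (by lia)
  have hX : (0 : ℝ) < (t : ℝ) + 1 := by positivity
  set n : ℝ := ((τ.seen t + 1 : ℕ) : ℝ) with hn
  have hn0 : 0 < n := by positivity
  have hXn : (t : ℝ) + 1 ≤ 2 * n := by
    have : (t : ℕ) + 1 ≤ 2 * (τ.seen t + 1) := by lia
    rw [hn]
    exact_mod_cast this
  have hsq : (√(ν * k) * ((t : ℝ) + 1) ^ (3 / 4 : ℝ)) ^ 2
      = ν * k * (((t : ℝ) + 1) * √((t : ℝ) + 1)) := by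
    rw [rpow_three_quarters hX.le, mul_pow, mul_pow, Real.sq_sqrt hN.le, Real.sq_sqrt hX.le,
      sq_rpow_one_quarter hX.le]
  have hs : √((t : ℝ) + 1) ≤ 2 * √n := by
    have : √((t : ℝ) + 1) ≤ √(2 ^ 2 * n) := Real.sqrt_le_sqrt (by linarith)
    rwa [Real.sqrt_mul (by norm_num), Real.sqrt_sq (by norm_num)] at this
  -- With `t + 1 ≤ 2n` the left side is at most `4n√n`, while the rate sum is at least `νk n√n / 2`.
  -- The resulting factor 8 is rounded up to the square 9.
  have h2 : ((t : ℝ) + 1) * √((t : ℝ) + 1) ≤ 2 * n * (2 * √n) := by gcongr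
  have h3 : (√(ν * k) * ((t : ℝ) + 1) ^ (3 / 4 : ℝ)) ^ 2
      ≤ 9 * rateSum k r ν δ τ (τ.seen t + 1) := by
    rw [hsq]
    have h4 : ν * k * (((t : ℝ) + 1) * √((t : ℝ) + 1)) ≤ ν * k * (2 * n * (2 * √n)) := by gcongr
    have h5 : 0 < ν * k * (n * √n) := by positivity
    nlinarith
  have h6 : √(9 * rateSum k r ν δ τ (τ.seen t + 1)) = 3 * √(rateSum k r ν δ τ (τ.seen t + 1)) := by
    rw [Real.sqrt_mul (by norm_num), show (9 : ℝ) = 3 ^ 2 by norm_num, Real.sqrt_sq (by norm_num)]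
  rw [← h6]
  exact Real.le_sqrt_of_sq_le h3

end IsSmoothingSchedule

end RateBounds

/-! ### Summation of all error terms. -/

section MainBound

variable {k T : ℕ} {K : Set (Eucl k)} {z₁ : Eucl k} {r ν : ℝ} {δ : ℕ → ℝ}
  {f : Fin T → Eucl k → ℝ} {D G M : ℝ} {τ : Timeline T}

/-- The total drift of the iterates over the latency intervals. -/
lemma sum_drift_le
    (H : WrapperAssumptions K z₁ (learningRate k D G r ν δ τ) r δ f D G M)
    (hδ : IsSmoothingSchedule T k r ν δ) (hN : 0 < ν * k) (hT : 1 ≤ T) :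
    ∑ t : Fin T, G * min D ((G * (√(ν * k) * (T : ℝ) ^ (1 / 4 : ℝ))) ^ 2 / G
        * learningRate k D G r ν δ τ (τ.seen t + 1)
      + ∑ j ∈ Finset.Ico (τ.seen t) (τ.obsPos t), 2 * G * learningRate k D G r ν δ τ (j + 1))
      ≤ G * D * (6 * √(τ.totalDelay : ℝ) + 12 * (((T : ℝ) ^ (1 / 4 : ℝ)) ^ 3 * √(ν * k))) := by
  have hr := H.r_pos
  have hG := H.G_pos
  have hD := H.D_pos
  have hT0 : (0 : ℝ) < T := by exact_mod_cast hT
  have hηpos : ∀ n, 0 < learningRate k D G r ν δ τ (n + 1) := H.rate_pos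
  set η := learningRate k D G r ν δ τ with hη
  set B := rateSum k r ν δ τ with hB
  have hηB : ∀ n, η n = (D / G) / √(B n) := fun n => rfl
  have hBpos : ∀ n, 0 < √(B (n + 1)) := fun n => Real.sqrt_pos.2 (rateSum_succ_pos _ _ _ _ _ n)
  set q := (T : ℝ) ^ (1 / 4 : ℝ) with hq
  have hq0 : 0 < q := Real.rpow_pos_of_pos hT0 _
  set N := ν * k with hNdef
  have hs0 : 0 < √N := Real.sqrt_pos.2 hN
  set d := √(τ.totalDelay : ℝ) with hd
  have h1 : ∀ t : Fin T, G * min D ((G * (√N * q)) ^ 2 / G * η (τ.seen t + 1)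
      + ∑ j ∈ Finset.Ico (τ.seen t) (τ.obsPos t), 2 * G * η (j + 1))
      ≤ G * D * (if 2 * τ.seen t < t then 1 else 0)
        + 3 * (G * D) * √N * q ^ 2 * (((t : ℕ) : ℝ) + 1) ^ (-(3 / 4) : ℝ)
        + ∑ j ∈ Finset.Ico (τ.seen t) (τ.obsPos t), 2 * G ^ 2 * η (j + 1) := by
    intro t
    have hsum0 : 0 ≤ ∑ j ∈ Finset.Ico (τ.seen t) (τ.obsPos t), 2 * G ^ 2 * η (j + 1) :=
      Finset.sum_nonneg fun j _ => by have := hηpos j; positivity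
    have hX : (0 : ℝ) < ((t : ℕ) : ℝ) + 1 := by positivity
    -- A round that has seen less than half of its predecessors pays the diameter. In any other
    -- round the denominator is of order `√(νk) (t + 1)^(3/4)`, so the noise term is summable to
    -- order `T^(1/4)`.
    split_ifs with h
    · have h2 : G * min D ((G * (√N * q)) ^ 2 / G * η (τ.seen t + 1)
          + ∑ j ∈ Finset.Ico (τ.seen t) (τ.obsPos t), 2 * G * η (j + 1)) ≤ G * D :=
        mul_le_mul_of_nonneg_left (min_le_left _ _) hG.le
      have h3 : 0 ≤ 3 * (G * D) * √N * q ^ 2 * (((t : ℕ) : ℝ) + 1) ^ (-(3 / 4) : ℝ) := by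
        positivity
      linarith
    · rw [mul_zero, zero_add]
      refine (mul_le_mul_of_nonneg_left (min_le_right _ _) hG.le).trans ?_
      rw [mul_add, Finset.mul_sum]
      refine add_le_add ?_ (le_of_eq (Finset.sum_congr rfl fun j _ => by ring))
      have h4 := hδ.sqrt_mul_rpow_le hr hN τ (t := t) (by lia)
      have h5 := hBpos (τ.seen t)
      have hY : 0 < (((t : ℕ) : ℝ) + 1) ^ (3 / 4 : ℝ) := Real.rpow_pos_of_pos hX _
      rw [hηB, Real.rpow_neg hX.le]
      calc G * ((G * (√N * q)) ^ 2 / G * (D / G / √(B (τ.seen t + 1))))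
          = G * D * √N * q ^ 2 * (√N / √(B (τ.seen t + 1))) := by field_simp
        _ ≤ G * D * √N * q ^ 2 * (3 * ((((t : ℕ) : ℝ) + 1) ^ (3 / 4 : ℝ))⁻¹) := by
            gcongr
            rw [div_le_iff₀ h5, mul_assoc, mul_comm _ √(B (τ.seen t + 1)), ← mul_assoc,
              ← div_eq_mul_inv, le_div_iff₀ hY]
            exact h4
        _ = _ := by ring
  have h2 : ∑ t : Fin T, (if 2 * τ.seen t < t then (1 : ℝ) else 0) ≤ 2 * d := by
    rw [Finset.sum_boole]
    exact τ.card_filter_two_mul_seen_lt_le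
  have h3 := sum_rpow_neg_le (p := 3 / 4) (by norm_num) (by norm_num) T
  have h3' : ∑ t : Fin T, (((t : ℕ) : ℝ) + 1) ^ (-(3 / 4) : ℝ) ≤ 4 * q := by
    refine h3.trans (le_of_eq ?_)
    rw [hq]
    norm_num
    ring
  have h4 : ∑ t, ∑ j ∈ Finset.Ico (τ.seen t) (τ.obsPos t), 2 * G ^ 2 * η (j + 1)
      ≤ 4 * (G * D) * d := by
    rw [τ.sum_sum_Ico_seen_obsPos fun j => 2 * G ^ 2 * η (j + 1)]
    have h5 := sum_div_sqrt_le (x := fun m => (τ.dualBacklog (τ.obsOrder m) : ℝ))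
      (y := fun m : Fin T => B ((m : ℕ) + 1)) (fun m => Nat.cast_nonneg _)
      (sum_ite_dualBacklog_le k r ν δ τ)
    rw [Equiv.sum_comp τ.obsOrder fun t => (τ.dualBacklog t : ℝ), ← Nat.cast_sum,
      τ.sum_dualBacklog] at h5
    calc _ = 2 * (G * D) * ∑ m : Fin T,
          (τ.dualBacklog (τ.obsOrder m) : ℝ) / √(B ((m : ℕ) + 1)) := by
          rw [Finset.mul_sum]
          refine Finset.sum_congr rfl fun m _ => ?_
          have := hBpos m
          rw [hηB]
          field_simp
      _ ≤ 2 * (G * D) * (2 * d) := by gcongr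
      _ = _ := by ring
  calc _ ≤ ∑ t : Fin T, (G * D * (if 2 * τ.seen t < t then 1 else 0)
        + 3 * (G * D) * √N * q ^ 2 * (((t : ℕ) : ℝ) + 1) ^ (-(3 / 4) : ℝ)
        + ∑ j ∈ Finset.Ico (τ.seen t) (τ.obsPos t), 2 * G ^ 2 * η (j + 1)) :=
        Finset.sum_le_sum fun t _ => h1 t
    _ = G * D * ∑ t : Fin T, (if 2 * τ.seen t < t then (1 : ℝ) else 0)
        + 3 * (G * D) * √N * q ^ 2 * ∑ t : Fin T, (((t : ℕ) : ℝ) + 1) ^ (-(3 / 4) : ℝ)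
        + ∑ t, ∑ j ∈ Finset.Ico (τ.seen t) (τ.obsPos t), 2 * G ^ 2 * η (j + 1) := by
        rw [Finset.sum_add_distrib, Finset.sum_add_distrib, Finset.mul_sum, Finset.mul_sum]
    _ ≤ G * D * (2 * d) + 3 * (G * D) * √N * q ^ 2 * (4 * q) + 4 * (G * D) * d := by gcongr
    _ = _ := by ring

/-- The regret bound in the regime `1 ≤ ν k √T`, `ν k ≤ √T`. -/
lemma integral_wrapperRegret_le
    (H : WrapperAssumptions K z₁ (learningRate k D G r ν δ τ) r δ f D G M)
    (hδ : IsSmoothingSchedule T k r ν δ) (hM : M = ν * (G * r)) (hN : 0 < ν * k) (hT : 1 ≤ T)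
    (hNT : ν * k ≤ √T) (hNT' : 1 ≤ ν * k * √T) {x : Eucl k} (hx : x ∈ K) :
    ∫ u, wrapperRegret (pftrl K z₁ (learningRate k D G r ν δ τ)) r δ τ f u x ∂(directionLaw k T)
      ≤ 24 * (G * D * (√(τ.totalDelay : ℝ) + (T : ℝ) ^ (3 / 4 : ℝ) * √(ν * k))) := by
  have hr := H.r_pos
  have hG := H.G_pos
  have hD := H.D_pos
  have hT0 : (0 : ℝ) < T := by exact_mod_cast hT
  set N := ν * k with hNdef
  set η := learningRate k D G r ν δ τ with hη
  set B := rateSum k r ν δ τ with hB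
  set a := lossScale k r ν δ τ with ha
  have hηB : ∀ n, η n = (D / G) / √(B n) := fun n => rfl
  have hBpos : ∀ n, 0 < √(B (n + 1)) := fun n => Real.sqrt_pos.2 (rateSum_succ_pos _ _ _ _ _ n)
  set q := (T : ℝ) ^ (1 / 4 : ℝ) with hq
  have hq0 : 0 < q := Real.rpow_pos_of_pos hT0 _
  have hq2 : √(T : ℝ) = q ^ 2 := (sq_rpow_one_quarter hT0.le).symm
  have hq3 : (T : ℝ) ^ (3 / 4 : ℝ) = q ^ 3 := by rw [rpow_three_quarters hT0.le, hq2]; ring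
  have hq4 : (T : ℝ) = q ^ 4 := by rw [← Real.sq_sqrt hT0.le, hq2]; ring
  have hs0 : 0 < √N := Real.sqrt_pos.2 hN
  have hsN := Real.sq_sqrt hN.le
  set d := √(τ.totalDelay : ℝ) with hd
  have hkM : k * M = G * (N * r) := by rw [hM, hNdef]; ring
  have hsuma : √(∑ m, a m ^ 2) ≤ q ^ 3 * √N := by
    refine Real.sqrt_le_iff.2 ⟨by positivity, ?_⟩
    calc ∑ m, a m ^ 2 ≤ ∑ _m : Fin T, N * √T :=
          Finset.sum_le_sum fun m _ => hδ.lossScale_sq_le hr hN τ hNT m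
      _ = T * (N * √T) := by simp
      _ = _ := by rw [hq2, hq4, mul_pow, hsN]; ring
  have hL : ∀ t : Fin T, k * M / δ ((t : ℕ) + 1) ≤ G * (√N * q) := by
    intro t
    have h1 := hδ.lower hNT ((t : ℕ) + 1) (by lia) t.2
    rw [hkM, div_le_iff₀ (H.delta_pos t)]
    calc G * (N * r) = G * (√N * q) * (r * (√N / q)) := by
          field_simp
          rw [hsN]
      _ ≤ _ := by gcongr
  have hmain := H.integral_regret_le τ hT hL (by positivity) hx
  -- smoothing bias
  have hbias : ∑ t : Fin T, 7 * (G * D) * (δ ((t : ℕ) + 1) / r)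
      ≤ 28 / 3 * (G * D) * (q ^ 3 * √N) := by
    have h1 : ∀ t : Fin T, δ ((t : ℕ) + 1) / r ≤ √N * (((t : ℕ) : ℝ) + 1) ^ (-(1 / 4) : ℝ) := by
      intro t
      have h2 := hδ.upper ((t : ℕ) + 1) (by lia) t.2
      rw [div_le_iff₀ hr, Real.rpow_neg (by positivity)]
      push_cast at h2
      calc _ ≤ _ := h2
        _ = _ := by ring
    have h3 := sum_rpow_neg_le (p := 1 / 4) (by norm_num) (by norm_num) T
    norm_num at h3
    rw [hq3] at h3
    calc _ ≤ ∑ t : Fin T, 7 * (G * D) * (√N * (((t : ℕ) : ℝ) + 1) ^ (-(1 / 4) : ℝ)) := by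
          gcongr with t
          exact h1 t
      _ = 7 * (G * D) * √N * ∑ t : Fin T, (((t : ℕ) : ℝ) + 1) ^ (-(1 / 4) : ℝ) := by
          rw [Finset.mul_sum]
          exact Finset.sum_congr rfl fun t _ => by ring
      _ ≤ 7 * (G * D) * √N * (q ^ 3 / (3 / 4)) := by gcongr
      _ = _ := by ring
  -- regularization
  have hreg : D ^ 2 / (2 * η T) ≤ G * D / 2 * (d + 2 * (q ^ 3 * √N)) := by
    obtain ⟨T', rfl⟩ : ∃ T', T = T' + 1 := ⟨T - 1, by lia⟩
    have h1 : D ^ 2 / (2 * η (T' + 1)) = G * D / 2 * √(B (T' + 1)) := by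
      have := hBpos T'
      rw [hηB]
      field_simp
    rw [h1]
    gcongr
    rw [hB, rateSum_card]
    set A := ∑ m, lossScale k r ν δ τ m ^ 2
    have hA : 0 ≤ A := Finset.sum_nonneg fun _ _ => sq_nonneg _
    set t := ((T' + 1 : ℕ) : ℝ)
    -- This is where `1 ≤ νk√T` enters: the summand `n` of the rate denominator is absorbed into the
    -- main term.
    have h2 : √t ≤ q ^ 3 * √N := by
      refine Real.sqrt_le_iff.2 ⟨by positivity, ?_⟩
      rw [mul_pow, hsN, hq4]
      rw [hq2] at hNT'
      have : 0 < q ^ 4 := by positivity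
      nlinarith
    have h3 : √(t + (τ.totalDelay : ℝ) + A) ≤ √t + d + √A := by
      exact sqrt_add_add_le (Nat.cast_nonneg _) (Nat.cast_nonneg _) hA
    linarith
  -- stability
  have hstab : ∑ m : Fin T, η ((m : ℕ) + 1) * (k * M / δ ((τ.obsOrder m : ℕ) + 1)) ^ 2 / 2
      ≤ G * D * (q ^ 3 * √N) := by
    have h1 : ∀ m : Fin T, η ((m : ℕ) + 1) * (k * M / δ ((τ.obsOrder m : ℕ) + 1)) ^ 2 / 2
        ≤ G * D / 2 * (a m ^ 2 / √(B ((m : ℕ) + 1))) := by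
      intro m
      -- Feedback never arrives before its own round and the radii do not increase, so the scale in
      -- the learning rate dominates the actual loss vector up to the factor `G`.
      have h2 := hδ.anti ((τ.obsOrder m : ℕ) + 1)
        ((τ.obsOrder m : ℕ) + 1 + τ.delay (τ.obsOrder m)) (by lia) (by lia)
      have hlt := τ.add_delay_lt (τ.obsOrder m)
      have h3 := hδ.pos ((τ.obsOrder m : ℕ) + 1 + τ.delay (τ.obsOrder m)) (by lia) (by lia)
      have h4 : k * M / δ ((τ.obsOrder m : ℕ) + 1) ≤ G * a m := by
        rw [hkM, mul_div_assoc]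
        simp only [ha, lossScale]
        gcongr
      have h5 : 0 ≤ k * M / δ ((τ.obsOrder m : ℕ) + 1) := by
        rw [hkM]
        exact div_nonneg (by positivity) (h3.le.trans h2)
      have h6 := hBpos m
      rw [hηB]
      calc D / G / √(B ((m : ℕ) + 1)) * (k * M / δ ((τ.obsOrder m : ℕ) + 1)) ^ 2 / 2
          ≤ D / G / √(B ((m : ℕ) + 1)) * (G * a m) ^ 2 / 2 := by gcongr
        _ = _ := by field_simp
    have h7 := sum_div_sqrt_le (x := fun m => a m ^ 2) (y := fun m : Fin T => B ((m : ℕ) + 1))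
      (fun m => sq_nonneg _) (sum_ite_lossScale_le k r ν δ τ)
    calc _ ≤ ∑ m : Fin T, G * D / 2 * (a m ^ 2 / √(B ((m : ℕ) + 1))) :=
          Finset.sum_le_sum fun m _ => h1 m
      _ = G * D / 2 * ∑ m : Fin T, a m ^ 2 / √(B ((m : ℕ) + 1)) := by rw [Finset.mul_sum]
      _ ≤ G * D / 2 * (2 * √(∑ m, a m ^ 2)) := by gcongr
      _ ≤ G * D / 2 * (2 * (q ^ 3 * √N)) := by gcongr
      _ = _ := by ring
  have hdrift := sum_drift_le H hδ hN hT
  rw [hq3]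
  refine hmain.trans ?_
  have hGD : 0 < G * D := by positivity
  have hd0 : 0 ≤ G * D * d := by positivity
  have hz0 : 0 ≤ G * D * (q ^ 3 * √N) := by positivity
  -- The coefficients add up to `28/3 + 1 + 1 + 12 < 24` for the smoothing term and to `1/2 + 6` for
  -- the delay term.
  nlinarith

end MainBound

/-! ### Verification of the assumptions and the remaining regimes. -/

lemma lipschitz_of_norm_gradientWithin_le {k : ℕ} {K : Set (Eucl k)} {f : Eucl k → ℝ} {G : ℝ}
    (hK : Convex ℝ K) (hf : DifferentiableOn ℝ f K)
    (hG : ∀ x ∈ K, ‖gradientWithin f K x‖ ≤ G) :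
    ∀ a ∈ K, ∀ b ∈ K, |f a - f b| ≤ G * ‖a - b‖ := by
  intro a ha b hb
  refine hK.norm_image_sub_le_of_norm_fderivWithin_le hf (fun x hx => ?_) hb ha
  have := hG x hx
  rwa [gradientWithin, LinearIsometryEquiv.norm_map] at this

theorem mainTheorem1 :
    ∃ C : ℝ, 0 < C ∧
      ∀ (k T : ℕ) (K : Set (Eucl k)) (f : Fin T → Eucl k → ℝ) (τ : Timeline T)
        (D G M r R ν : ℝ) (z₁ xstar : Eucl k) (δ : ℕ → ℝ),
        1 ≤ k →
        IsClosed K → Convex ℝ K →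
        0 < G → 0 < M → 0 < r → r < R →
        Metric.closedBall 0 r ⊆ K → K ⊆ Metric.closedBall 0 R →
        (∀ x ∈ K, ∀ y ∈ K, ‖x - y‖ ≤ D) →
        (∀ t, ConvexOn ℝ K (f t)) →
        (∀ t, DifferentiableOn ℝ (f t) K) →
        (∀ t, ∀ x ∈ K, ‖gradientWithin (f t) K x‖ ≤ G) →
        (∀ t, ∀ x ∈ K, |f t x| ≤ M) →
        ν = M / (G * r) →
        (δ = roundSchedule k r ν ∨ δ = fixedSchedule k T r ν) →
        z₁ ∈ K →
        xstar ∈ K → IsMinOn (fun x => ∑ t, f t x) K xstar →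
        Integrable
            (fun u => wrapperRegret (pftrl K z₁ (learningRate k D G r ν δ τ)) r δ τ f u xstar)
            (directionLaw k T) ∧
          ∫ u, wrapperRegret (pftrl K z₁ (learningRate k D G r ν δ τ)) r δ τ f u xstar
              ∂(directionLaw k T)
            ≤ C * (G * D * (√(τ.totalDelay : ℝ) + (T : ℝ) ^ (3 / 4 : ℝ) * √(ν * k))) := by
  refine ⟨24, by norm_num, ?_⟩
  intro k T K f τ D G M r R ν z₁ xstar δ hk hclosed hconv hG hM hr _ hball hR hdiam hfc hfd hfG hfM
    hν hδ hz₁ hx _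
  have hk0 : (0 : ℝ) < k := by exact_mod_cast hk
  have hν0 : 0 < ν := by rw [hν]; positivity
  have hN : 0 < ν * k := by positivity
  have hMν : M = ν * (G * r) := by rw [hν]; field_simp
  have hsched : IsSmoothingSchedule T k r ν δ := by
    rcases hδ with rfl | rfl
    · exact isSmoothingSchedule_roundSchedule hr hN
    · exact isSmoothingSchedule_fixedSchedule hr hN
  have hD : 0 < D := by
    have h1 : EuclideanSpace.single ⟨0, hk⟩ r ∈ K := hball (by simp [abs_of_pos hr])
    have h2 := hdiam _ h1 0 (hball (by simp [hr.le]))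
    rw [sub_zero] at h2
    simp only [PiLp.norm_single, Real.norm_eq_abs, abs_of_pos hr] at h2
    linarith
  have H : WrapperAssumptions K z₁ (learningRate k D G r ν δ τ) r δ f D G M :=
    { one_le_k := hk
      compact := Metric.isCompact_of_isClosed_isBounded hclosed
        (Metric.isBounded_closedBall.subset hR)
      convex := hconv
      start_mem := hz₁
      r_pos := hr
      ball_subset := hball
      diam_le := hdiam
      rate_pos := learningRate_succ_pos k D G r ν δ τ hD hG
      weight_nonneg := stepWeight_learningRate_nonneg k D G r ν δ τ hD hG
      delta_pos := fun t => hsched.pos _ (by lia) t.2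
      delta_le := fun t => hsched.le _
      G_pos := hG
      loss_convex := hfc
      loss_lipschitz := fun t => lipschitz_of_norm_gradientWithin_le hconv (hfd t) (hfG t)
      loss_bounded := hfM }
  refine ⟨H.integrable_regret τ xstar, ?_⟩
  rcases T.eq_zero_or_pos with rfl | hT
  · refine H.integral_regret_le_of_forall τ fun u => ?_
    simp only [wrapperRegret, Finset.univ_eq_empty, Finset.sum_empty]
    positivity
  have hT0 : (0 : ℝ) < T := by exact_mod_cast hT
  set q := (T : ℝ) ^ (1 / 4 : ℝ) with hq
  have hq0 : 0 < q := Real.rpow_pos_of_pos hT0 _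
  have hq2 : √(T : ℝ) = q ^ 2 := (sq_rpow_one_quarter hT0.le).symm
  have hq3 : (T : ℝ) ^ (3 / 4 : ℝ) = q ^ 3 := by rw [rpow_three_quarters hT0.le, hq2]; ring
  have hq4 : (T : ℝ) = q ^ 4 := by rw [← Real.sq_sqrt hT0.le, hq2]; ring
  have hGD : 0 < G * D := by positivity
  have hs0 : 0 < √(ν * k) := Real.sqrt_pos.2 hN
  have hsN := Real.sq_sqrt hN.le
  have hfinish : ∀ c, c ≤ G * D * (q ^ 3 * √(ν * k)) →
      c ≤ 24 * (G * D * (√(τ.totalDelay : ℝ) + (T : ℝ) ^ (3 / 4 : ℝ) * √(ν * k))) := by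
    intro c hc
    rw [hq3]
    have h1 : 0 ≤ G * D * √(τ.totalDelay : ℝ) := by positivity
    have h2 : 0 ≤ G * D * (q ^ 3 * √(ν * k)) := by positivity
    linarith
  by_cases hNT : ν * k ≤ √T
  · by_cases hNT' : 1 ≤ ν * k * √T
    · exact integral_wrapperRegret_le H hsched hMν hN hT hNT hNT' hx
    -- For `νk√T < 1` the losses themselves are small: the trivial bound `2MT`, with `2r ≤ D`,
    -- already lies below the target because `√(νk) T^(1/4) ≤ 1`.
    · refine hfinish _ ((H.integral_regret_le_of_forall τ
        fun u => H.regret_le_bounded τ u hx).trans ?_)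
      push Not at hNT'
      rw [hq2, ← hsN, ← mul_pow] at hNT'
      have h1 : √(ν * k) * q ≤ 1 := by
        have := abs_lt_of_sq_lt_sq (a := √(ν * k) * q) (b := 1) (by linarith) (by norm_num)
        exact (le_abs_self _).trans this.le
      have h2 := H.two_mul_r_le
      have h3 : ν ≤ ν * k := le_mul_of_one_le_right hν0.le (by exact_mod_cast hk)
      calc (T : ℝ) * (2 * M) = q ^ 4 * (ν * G * (2 * r)) := by rw [hq4, hMν]; ring
        _ ≤ q ^ 4 * (ν * k * G * D) := by gcongr
        _ = q ^ 4 * (√(ν * k) ^ 2 * G * D) := by rw [hsN]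
        _ = G * D * (q ^ 3 * √(ν * k)) * (√(ν * k) * q) := by ring
        _ ≤ G * D * (q ^ 3 * √(ν * k)) := mul_le_of_le_one_right (by positivity) h1
  -- For `νk > √T` the target exceeds `G * D * T`, the trivial bound for Lipschitz losses.
  · refine hfinish _ ((H.integral_regret_le_of_forall τ
      fun u => H.regret_le_lipschitz τ u hx).trans ?_)
    push Not at hNT
    have h1 : q ≤ √(ν * k) := by
      refine Real.le_sqrt_of_sq_le ?_
      rw [← hq2]
      exact hNT.le
    calc (T : ℝ) * (G * D) = G * D * (q ^ 3 * q) := by rw [hq4]; ring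
      _ ≤ _ := by gcongr
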